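/- Let $K\in\mathbb R$, $N\in(1,\infty)$, $Q\ge 1$, and let $h:\mathbb R\to[0,\infty)$ be a Lebesgue measurable function which is continuous on its support $\operatorname{supp} h:=\operatorname{supp}(h\mathcal L^1)$, where $\mathcal L^1$ is Lebesgue measure. Then the metric measure space $(\mathbb R,|\cdot|,h\mathcal L^1)$ satisfies $\mathsf{QCD}(Q,K,N)$ if and only if $h$ is a $\mathsf{QCD}(Q,K,N)$ density, i.e. if and only if for all $x_0,x_1\in\operatorname{supp}h$ and $t\in(0,1)$ $$h^{\frac1{N-1}}(tx_1+(1-t)x_0)\ \ge\ \frac1{Q^{\frac1{N-1}}}\Big(\sigma^{(1-t)}_{K,N-1}(|x_1-x_0|)\,h^{\frac1{N-1}}(x_0)+\sigma^{(t)}_{K,N-1}(|x_1-x_0|)\,h^{\frac1{N-1}}(x_1)\Big).$$ Here inequalities are in $[0,\infty]$ with $\infty\cdot0=0$. For $\theta\ge0$, $\sigma^{(t)}_{K,N-1}(\theta)=+\infty$ if $K\theta^2\ge\pi^2(N-1)$, and otherwise $\sigma^{(t)}_{K,N-1}(\theta)=s_{K/(N-1)}(t\theta)/s_{K/(N-1)}(\theta)$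 (read as $t$ when $\theta=0$), with $s_\kappa(\theta)=\frac{\sin(\sqrt\kappa\,\theta)}{\sqrt\kappa}$, $\theta$, $\frac{\sinh(\sqrt{-\kappa}\,\theta)}{\sqrt{-\kappa}}$ for $\kappa>0$, $\kappa=0$, $\kappa<0$ respectively; and $\tau^{(t)}_{K,N}(\theta)=t^{1/N}\big(\sigma^{(t)}_{K,N-1}(\theta)\big)^{1-1/N}$. Let $(X,d)$ be a complete separable metric space with a locally finite Borel measure $\mathfrak m$. $\mathrm{Geo}(X,d)$ is the space of constant speed minimizing geodesics $\gamma:[0,1]\to X$ with the uniform topology, $\mathrm e_t(\gamma)=\gamma_t$, and $\mathrm{OptGeo}(\mu_0,\mu_1)$ is the set of Borel probability measures $\nu$ on $\mathrm{Geo}(X,d)$ such that $(\mathrm e_0,\mathrm e_1)_\sharp\nu$ is an optimal transference plan between $\mu_0$ and $\mu_1$ for the cost $d^2$ (with finite cost). The space is Monge if for all Borel probability measures $\mu_0,\mu_1$ with finite second moments, $\mu_0\ll\mathfrak m$ and $\operatorname{supp}\mu_1\subset\operatorname{supp}\mathfrak m$, there is a unique $\nu\in\mathrm{OptGeo}(\mu_0,\mu_1)$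 (and a unique optimal transference plan), it has the form $\nu=S_\sharp\mu_0$ for a measurable map $S:X\to\mathrm{Geo}(X,d)$, and $(\mathrm e_t)_\sharp\nu\ll\mathfrak m$ for all $t\in[0,1)$. The space satisfies $\mathsf{QCD}(Q,K,N)$ if it is Monge and for all Borel probability measures $\mu_0,\mu_1\ll\mathfrak m$ with bounded support and all $t\in(0,1)$, writing $\nu$ for the unique element of $\mathrm{OptGeo}(\mu_0,\mu_1)$ and $\rho_t=\frac{d(\mathrm e_t)_\sharp\nu}{d\mathfrak m}$, one has for $\nu$-a.e. $\gamma$ $$\rho_t^{-\frac1N}(\gamma_t)\ \ge\ \frac1{Q^{\frac1N}}\Big(\tau^{(1-t)}_{K,N}(d(\gamma_0,\gamma_1))\,\rho_0^{-\frac1N}(\gamma_0)+\tau^{(t)}_{K,N}(d(\gamma_0,\gamma_1))\,\rho_1^{-\frac1N}(\gamma_1)\Big).$$ -/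

import Mathlib

open MeasureTheory Set
open scoped NNReal ENNReal unitInterval

noncomputable section

namespace QCDSpace

/-! ### Geodesics, optimal transport and Monge spaces -/

section MetricMeasure

variable {X : Type*} [MetricSpace X]

/-- `Geo(X,d)`: constant speed minimizing geodesics parametrized on `[0,1]`, with the
uniform topology (on the compact interval this is the topology of `C([0,1], X)`). -/
def Geo (X : Type*) [MetricSpace X] : Type _ :=
  {γ : C(I, X) // ∀ s t : I, dist (γ s) (γ t) = |(s : ℝ) - (t : ℝ)| * dist (γ 0) (γ 1)}

instance : TopologicalSpace (Geo X) :=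
  inferInstanceAs (TopologicalSpace
    {γ : C(I, X) // ∀ s t : I, dist (γ s) (γ t) = |(s : ℝ) - (t : ℝ)| * dist (γ 0) (γ 1)})

instance : MeasurableSpace (Geo X) := borel (Geo X)

instance : BorelSpace (Geo X) := ⟨rfl⟩

/-- The evaluation map `e_t : Geo(X,d) → X`, `γ ↦ γ_t`. -/
def Geo.eval (t : I) (γ : Geo X) : X := γ.1 t

variable [MeasurableSpace X]

/-- The quadratic cost `∫ d(x,y)² π(dx,dy)`. -/
def transportCost (π : Measure (X × X)) : ℝ≥0∞ := ∫⁻ z, edist z.1 z.2 ^ 2 ∂π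

/-- `π` has marginals `μ₀` and `μ₁`. -/
def IsTransferencePlan (μ₀ μ₁ : Measure X) (π : Measure (X × X)) : Prop :=
  π.map Prod.fst = μ₀ ∧ π.map Prod.snd = μ₁

/-- `π ∈ Opt(μ₀,μ₁)`: a transference plan of finite and minimal quadratic cost. -/
def IsOptimalPlan (μ₀ μ₁ : Measure X) (π : Measure (X × X)) : Prop :=
  IsTransferencePlan μ₀ μ₁ π ∧ transportCost π ≠ ⊤ ∧
    ∀ π' : Measure (X × X), IsTransferencePlan μ₀ μ₁ π' → transportCost π ≤ transportCost π'

/-- `ν ∈ OptGeo(μ₀,μ₁)`: a probability measure on `Geo(X,d)` with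
`(e₀,e₁)_♯ ν ∈ Opt(μ₀,μ₁)` (so in particular `(e_i)_♯ ν = μ_i`). -/
def IsOptimalDynamicalPlan (μ₀ μ₁ : Measure X) (ν : Measure (Geo X)) : Prop :=
  IsProbabilityMeasure ν ∧
    IsOptimalPlan μ₀ μ₁ (ν.map fun γ => (Geo.eval 0 γ, Geo.eval 1 γ))

/-- `μ ∈ P₂(X)`: a probability measure with finite second moment. -/
def IsP2 (μ : Measure X) : Prop :=
  IsProbabilityMeasure μ ∧ ∃ x₀ : X, ∫⁻ x, edist x x₀ ^ 2 ∂μ < ⊤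

/-- `μ ∈ P_c(X)`: a probability measure with bounded support. -/
def IsPc (μ : Measure X) : Prop :=
  IsProbabilityMeasure μ ∧ Bornology.IsBounded μ.support

/-- Monge spaces. The metric measure space `(X,d,m)` is complete, separable, with its Borel
`σ`-algebra, and `m` is locally finite. -/
structure IsMonge [CompleteSpace X] [SecondCountableTopology X] [BorelSpace X]
    (m : Measure X) : Prop where
  locallyFinite : IsLocallyFiniteMeasure m
  monge : ∀ μ₀ μ₁ : Measure X, IsP2 μ₀ → IsP2 μ₁ → μ₀ ≪ m → μ₁.support ⊆ m.support →
    (∃! π : Measure (X × X), IsOptimalPlan μ₀ μ₁ π) ∧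
    ∃ ν : Measure (Geo X), IsOptimalDynamicalPlan μ₀ μ₁ ν ∧
      (∀ ν' : Measure (Geo X), IsOptimalDynamicalPlan μ₀ μ₁ ν' → ν' = ν) ∧
      (∃ S : X → Geo X, Measurable S ∧ ν = μ₀.map S) ∧
      ∀ t : I, t < 1 → ν.map (Geo.eval t) ≪ m

end MetricMeasure

/-! ### Distortion coefficients -/

/-- The function `s_κ`. -/
def sFun (κ θ : ℝ) : ℝ :=
  if 0 < κ then 1 / √κ * Real.sin (√κ * θ)
  else if κ = 0 then θ
  else 1 / √(-κ) * Real.sinh (√(-κ) * θ)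

/-- `σ^{(t)}_{K,M}(θ)` for `θ ≥ 0`, `t ∈ [0,1]` and `M > 0` (used with `M = N - 1`);
at `θ = 0` the quotient is read as its limit `t`. -/
def sigma (K M t θ : ℝ) : ℝ≥0∞ :=
  if Real.pi ^ 2 * M ≤ K * θ ^ 2 then ⊤
  else if θ = 0 then ENNReal.ofReal t
  else ENNReal.ofReal (sFun (K / M) (t * θ) / sFun (K / M) θ)

/-- `τ^{(t)}_{K,N}(θ) = t^{1/N} σ^{(t)}_{K,N-1}(θ)^{1-1/N}`. -/
def tau (K N t θ : ℝ) : ℝ≥0∞ :=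
  ENNReal.ofReal t ^ (1 / N) * sigma K (N - 1) t θ ^ (1 - 1 / N)

/-! ### The condition `QCD(Q,K,N)` and one-dimensional `QCD(Q,K,N)` densities

All inequalities are between elements of `[0,∞]`, with `∞ * 0 = 0`. -/

/-- `(X,d,m)` is a Monge space satisfying `QCD(Q,K,N)`, where `ρ_t = d((e_t)_♯ ν)/dm`. -/
def SatisfiesQCD {X : Type*} [MetricSpace X] [MeasurableSpace X] [CompleteSpace X]
    [SecondCountableTopology X] [BorelSpace X] (Q K N : ℝ) (m : Measure X) : Prop :=
  IsMonge m ∧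
  ∀ μ₀ μ₁ : Measure X, IsPc μ₀ → IsPc μ₁ → μ₀ ≪ m → μ₁ ≪ m →
    ∀ ν : Measure (Geo X), IsOptimalDynamicalPlan μ₀ μ₁ ν →
      ∀ t : I, 0 < t → t < 1 → ∀ᵐ γ ∂ν,
        (ENNReal.ofReal Q ^ (1 / N))⁻¹ *
          (tau K N (1 - (t : ℝ)) (dist (γ.eval 0) (γ.eval 1)) *
              μ₀.rnDeriv m (γ.eval 0) ^ (-(1 / N)) +
            tau K N (t : ℝ) (dist (γ.eval 0) (γ.eval 1)) *
              μ₁.rnDeriv m (γ.eval 1) ^ (-(1 / N)))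
        ≤ (ν.map (Geo.eval t)).rnDeriv m (γ.eval t) ^ (-(1 / N))

/-- The measure `h 𝓛¹` on `ℝ`. -/
def densityMeasure (h : ℝ → ℝ≥0) : Measure ℝ :=
  (volume : Measure ℝ).withDensity fun x => (h x : ℝ≥0∞)

/-- `supp h := supp (h 𝓛¹)`. -/
def densitySupport (h : ℝ → ℝ≥0) : Set ℝ := (densityMeasure h).support

/-- `h` is a one-dimensional `QCD(Q,K,N)` density. -/
def IsQCDDensity (Q K N : ℝ) (h : ℝ → ℝ≥0) : Prop :=
  ContinuousOn h (densitySupport h) ∧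
  ∀ x₀ ∈ densitySupport h, ∀ x₁ ∈ densitySupport h, ∀ t : ℝ, 0 < t → t < 1 →
    (ENNReal.ofReal Q ^ (1 / (N - 1)))⁻¹ *
      (sigma K (N - 1) (1 - t) |x₁ - x₀| * (h x₀ : ℝ≥0∞) ^ (1 / (N - 1)) +
        sigma K (N - 1) t |x₁ - x₀| * (h x₁ : ℝ≥0∞) ^ (1 / (N - 1)))
    ≤ (h (t * x₁ + (1 - t) * x₀) : ℝ≥0∞) ^ (1 / (N - 1))

end QCDSpace

end

namespace QCDSpace

open Filter Topology ProbabilityTheory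

/-! ### Geodesics of the real line -/

/-! On the line optimal transport is explicit. A geodesic is a segment, so a dynamical plan is the
same thing as the coupling of its end points. Among couplings of finite cost only the comonotone one
is optimal (`IsMonotonePlan.isOptimalPlan_iff`): by Tonelli the quadratic cost is an integral of
crossing masses, which decrease as the joint distribution function grows, and the comonotone
coupling has the largest one. When the first marginal has no atoms, it is the graph of the monotone
rearrangement `T`.

Put `T_t = (1-t) id + t T`. Differentiating distribution functions gives the Jacobian equation `f₀ =
f_t(T_t) T_t'` for the Lebesgue densities `f = ρ h`. Cancelling `f₀^{-1/N}` turns the transport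
inequality into `TangentIneq` with `l = T'(x)` (`ae_qcd_iff_tangentIneq`). The density inequality is
the envelope of these over `l`: Hölder gives `TangentIneq` for every `l`
(`DensityIneq.tangentIneq`), and below the critical length the equality case of Hölder picks the `l`
that gives the density inequality back (`densityIneq_of_tangentIneq`).

For a density satisfying the inequality, `h` is positive where `T_t` lands and `T_t` expands by at
least `1-t`, so intermediate measures are absolutely continuous and the space is Monge. Conversely,
the Monge property makes the support convex, affine maps of slope `l` on small balls realize every
`l > 0`, and continuity carries the inequality from almost every point to the positive interior and
then to the whole support. -/

theorem Geo.continuous_eval {X : Type*} [MetricSpace X] (t : I) :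
    Continuous (Geo.eval t : Geo X → X) :=
  (continuous_eval_const t).comp continuous_subtype_val

theorem Geo.measurable_eval {X : Type*} [MetricSpace X] [MeasurableSpace X] [BorelSpace X]
    (t : I) : Measurable (Geo.eval t : Geo X → X) :=
  (Geo.continuous_eval t).measurable

theorem Geo.measurable_ends :
    Measurable fun γ : Geo ℝ => (Geo.eval 0 γ, Geo.eval 1 γ) :=
  (Geo.measurable_eval 0).prodMk (Geo.measurable_eval 1)

/-- The distances to the two ends add up to the full length; one bounds the point from above and the
other from below, which pins it. -/
theorem Geo.eval_real (γ : Geo ℝ) (t : I) :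
    γ.eval t = (1 - (t : ℝ)) * γ.eval 0 + t * γ.eval 1 := by
  have h0 := γ.2 t 0
  have h1 := γ.2 t 1
  simp only [Real.dist_eq, Icc.coe_zero, sub_zero, Icc.coe_one] at h0 h1
  change γ.1 t = (1 - (t : ℝ)) * γ.1 0 + t * γ.1 1
  rw [abs_of_nonneg t.2.1] at h0
  rw [abs_sub_comm (t : ℝ) 1, abs_of_nonneg (sub_nonneg.2 t.2.2)] at h1
  have a1 := le_abs_self (γ.1 t - γ.1 0)
  have a2 := neg_abs_le (γ.1 t - γ.1 0)
  have b1 := le_abs_self (γ.1 t - γ.1 1)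
  have b2 := neg_abs_le (γ.1 t - γ.1 1)
  rcases le_total (γ.1 0) (γ.1 1) with h | h
  · rw [abs_of_nonpos (sub_nonpos.2 h)] at h0 h1
    rw [h0] at a1 a2
    rw [h1] at b1 b2
    apply le_antisymm <;> linarith
  · rw [abs_of_nonneg (sub_nonneg.2 h)] at h0 h1
    rw [h0] at a1 a2
    rw [h1] at b1 b2
    apply le_antisymm <;> linarith

/-- The geodesic of the real line with given end points. -/
def lineGeo (p : ℝ × ℝ) : Geo ℝ :=
  ⟨⟨fun t => (1 - (t : ℝ)) * p.1 + t * p.2, by fun_prop⟩, fun s t => by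
    simp only [ContinuousMap.coe_mk, Real.dist_eq, Icc.coe_zero, Icc.coe_one]
    rw [← abs_mul, ← abs_neg]
    congr 1
    ring⟩

theorem eval_lineGeo (t : I) (p : ℝ × ℝ) :
    (lineGeo p).eval t = (1 - (t : ℝ)) * p.1 + t * p.2 := rfl

theorem measurable_lineGeo : Measurable lineGeo := by
  apply Continuous.measurable
  apply Continuous.subtype_mk
  apply ContinuousMap.continuous_of_continuous_uncurry
  simp only [Function.uncurry_def, ContinuousMap.coe_mk]
  fun_prop

theorem lineGeo_ends (γ : Geo ℝ) : lineGeo (γ.eval 0, γ.eval 1) = γ := by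
  apply Subtype.ext
  ext t
  exact (γ.eval_real t).symm

/-- A segment is determined by its ends, so dynamical plans and couplings correspond bijectively;
this lemma and the next are the two inverse identities. -/
theorem map_lineGeo_map_ends (ν : Measure (Geo ℝ)) :
    (ν.map fun γ => (Geo.eval 0 γ, Geo.eval 1 γ)).map lineGeo = ν := by
  rw [Measure.map_map measurable_lineGeo Geo.measurable_ends]
  simp [Function.comp_def, lineGeo_ends]

theorem map_ends_map_lineGeo (π : Measure (ℝ × ℝ)) :
    (π.map lineGeo).map (fun γ => (Geo.eval 0 γ, Geo.eval 1 γ)) = π := by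
  rw [Measure.map_map Geo.measurable_ends measurable_lineGeo]
  simp [Function.comp_def, eval_lineGeo]

/-! ### Quadratic optimal transport on the real line -/

/-- One of the two squares is empty and the other has side `|a - b|`. Writing the cost as an area
prepares it for Tonelli. -/
theorem edist_sq_eq_volume (a b : ℝ) :
    edist a b ^ 2 = volume (Ico a b ×ˢ Ico a b) + volume (Ico b a ×ˢ Ico b a) := by
  rw [Measure.volume_eq_prod, Measure.prod_prod, Measure.prod_prod, Real.volume_Ico,
    Real.volume_Ico, edist_dist, Real.dist_eq, sq]
  rcases le_total a b with h | h
  · rw [abs_of_nonpos (sub_nonpos.2 h), ENNReal.ofReal_of_nonpos (sub_nonpos.2 h)]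
    simp
  · rw [abs_of_nonneg (sub_nonneg.2 h), ENNReal.ofReal_of_nonpos (sub_nonpos.2 h)]
    simp

/-- The pairs of points that cross the interval `[s, t]` from left to right. -/
def upCrossing (s t : ℝ) : Set (ℝ × ℝ) := {z | z.1 ≤ s ∧ t < z.2}

/-- The pairs of points that cross the interval `[s, t]` from right to left. -/
def downCrossing (s t : ℝ) : Set (ℝ × ℝ) := {z | z.2 ≤ s ∧ t < z.1}

theorem measurableSet_upCrossing_pairs :
    MeasurableSet {q : (ℝ × ℝ) × (ℝ × ℝ) | q.1 ∈ upCrossing (min q.2.1 q.2.2) (max q.2.1 q.2.2)} := by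
  simp only [upCrossing, mem_ofPred_eq]
  have h1 : MeasurableSet {q : (ℝ × ℝ) × (ℝ × ℝ) | q.1.1 ≤ min q.2.1 q.2.2} :=
    measurableSet_le (by fun_prop) (by fun_prop)
  have h2 : MeasurableSet {q : (ℝ × ℝ) × (ℝ × ℝ) | max q.2.1 q.2.2 < q.1.2} :=
    measurableSet_lt (by fun_prop) (by fun_prop)
  exact h1.inter h2

theorem measurableSet_downCrossing_pairs :
    MeasurableSet
      {q : (ℝ × ℝ) × (ℝ × ℝ) | q.1 ∈ downCrossing (min q.2.1 q.2.2) (max q.2.1 q.2.2)} := by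
  simp only [downCrossing, mem_ofPred_eq]
  have h1 : MeasurableSet {q : (ℝ × ℝ) × (ℝ × ℝ) | q.1.2 ≤ min q.2.1 q.2.2} :=
    measurableSet_le (by fun_prop) (by fun_prop)
  have h2 : MeasurableSet {q : (ℝ × ℝ) × (ℝ × ℝ) | max q.2.1 q.2.2 < q.1.1} :=
    measurableSet_lt (by fun_prop) (by fun_prop)
  exact h1.inter h2

theorem measurable_crossing (π : Measure (ℝ × ℝ)) [SFinite π] :
    Measurable fun p : ℝ × ℝ => π (upCrossing (min p.1 p.2) (max p.1 p.2)) +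
      π (downCrossing (min p.1 p.2) (max p.1 p.2)) :=
  (measurable_measure_prodMk_right measurableSet_upCrossing_pairs).add
    (measurable_measure_prodMk_right measurableSet_downCrossing_pairs)

/-- Tonelli for the product of `π` and Lebesgue measure: a point `p` lies in the square attached to
`z` exactly when `z` crosses the interval spanned by the coordinates of `p`. -/
theorem transportCost_eq_lintegral_crossing (π : Measure (ℝ × ℝ)) [SFinite π] :
    transportCost π = ∫⁻ p : ℝ × ℝ, (π (upCrossing (min p.1 p.2) (max p.1 p.2)) +
      π (downCrossing (min p.1 p.2) (max p.1 p.2))) := by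
  have h1 := Measure.prod_apply (μ := π) (ν := (volume : Measure (ℝ × ℝ)))
    measurableSet_upCrossing_pairs
  have h2 := Measure.prod_apply (μ := π) (ν := (volume : Measure (ℝ × ℝ)))
    measurableSet_downCrossing_pairs
  rw [Measure.prod_apply_symm measurableSet_upCrossing_pairs] at h1
  rw [Measure.prod_apply_symm measurableSet_downCrossing_pairs] at h2
  have m1 : Measurable fun p : ℝ × ℝ => π (upCrossing (min p.1 p.2) (max p.1 p.2)) :=
    measurable_measure_prodMk_right measurableSet_upCrossing_pairs
  have m2 : Measurable fun z : ℝ × ℝ => volume (Prod.mk z ⁻¹'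
      {q : (ℝ × ℝ) × (ℝ × ℝ) | q.1 ∈ upCrossing (min q.2.1 q.2.2) (max q.2.1 q.2.2)}) :=
    measurable_measure_prodMk_left measurableSet_upCrossing_pairs
  rw [lintegral_add_left m1]
  refine Eq.trans ?_ (congrArg₂ (· + ·) h1.symm h2.symm)
  rw [← lintegral_add_left m2]
  refine lintegral_congr fun z => ?_
  rw [edist_sq_eq_volume]
  congr 2
  · ext p
    simp only [upCrossing, mem_prod, mem_Ico, mem_preimage, mem_ofPred_eq, le_min_iff, max_lt_iff]
    tauto
  · ext p
    simp only [downCrossing, mem_prod, mem_Ico, mem_preimage, mem_ofPred_eq, le_min_iff,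
      max_lt_iff]
    tauto

section Plans

variable {μ₀ μ₁ : Measure ℝ} {π : Measure (ℝ × ℝ)}

theorem IsTransferencePlan.measure_fst (hπ : IsTransferencePlan μ₀ μ₁ π) {s : Set ℝ}
    (hs : MeasurableSet s) : π (Prod.fst ⁻¹' s) = μ₀ s := by
  rw [← hπ.1, Measure.map_apply measurable_fst hs]

theorem IsTransferencePlan.measure_snd (hπ : IsTransferencePlan μ₀ μ₁ π) {s : Set ℝ}
    (hs : MeasurableSet s) : π (Prod.snd ⁻¹' s) = μ₁ s := by
  rw [← hπ.2, Measure.map_apply measurable_snd hs]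

theorem IsTransferencePlan.isProbabilityMeasure [IsProbabilityMeasure μ₀]
    (hπ : IsTransferencePlan μ₀ μ₁ π) : IsProbabilityMeasure π :=
  ⟨by simpa using hπ.measure_fst MeasurableSet.univ⟩

/-- The marginals fix this sum, so a larger joint distribution function means less crossing. -/
theorem IsTransferencePlan.upCrossing_add (hπ : IsTransferencePlan μ₀ μ₁ π) (s t : ℝ) :
    π (upCrossing s t) + π (Iic s ×ˢ Iic t) = μ₀ (Iic s) := by
  rw [← hπ.measure_fst measurableSet_Iic,
    ← measure_inter_add_sdiff (Prod.fst ⁻¹' Iic s) (measurable_snd measurableSet_Iic : MeasurableSet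
      (Prod.snd ⁻¹' Iic t : Set (ℝ × ℝ))), add_comm]
  congr 2
  ext z
  simp [upCrossing]

theorem IsTransferencePlan.downCrossing_add (hπ : IsTransferencePlan μ₀ μ₁ π) (s t : ℝ) :
    π (downCrossing s t) + π (Iic t ×ˢ Iic s) = μ₁ (Iic s) := by
  rw [← hπ.measure_snd measurableSet_Iic,
    ← measure_inter_add_sdiff (Prod.snd ⁻¹' Iic s) (measurable_fst measurableSet_Iic : MeasurableSet
      (Prod.fst ⁻¹' Iic t : Set (ℝ × ℝ))), add_comm]
  congr 2
  · ext z
    simp [and_comm, Prod.le_def]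
  · ext z
    simp [downCrossing]

/-- The Fréchet–Hoeffding upper bound, attained by the comonotone coupling. -/
theorem IsTransferencePlan.box_le (hπ : IsTransferencePlan μ₀ μ₁ π) (s t : ℝ) :
    π (Iic s ×ˢ Iic t) ≤ min (μ₀ (Iic s)) (μ₁ (Iic t)) := by
  rw [← hπ.measure_fst measurableSet_Iic, ← hπ.measure_snd measurableSet_Iic]
  exact le_min (measure_mono fun z hz => hz.1) (measure_mono fun z hz => hz.2)

/-- The comonotone coupling: its joint distribution function is the minimum of the marginal
distribution functions. -/
def IsMonotonePlan (μ₀ μ₁ : Measure ℝ) (π : Measure (ℝ × ℝ)) : Prop :=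
  IsTransferencePlan μ₀ μ₁ π ∧ ∀ s t, π (Iic s ×ˢ Iic t) = min (μ₀ (Iic s)) (μ₁ (Iic t))

variable [IsProbabilityMeasure μ₀]

theorem IsMonotonePlan.crossing_le {π' : Measure (ℝ × ℝ)} (hπ : IsMonotonePlan μ₀ μ₁ π)
    (hπ' : IsTransferencePlan μ₀ μ₁ π') (s t : ℝ) :
    π (upCrossing s t) ≤ π' (upCrossing s t) ∧ π (downCrossing s t) ≤ π' (downCrossing s t) := by
  have := hπ.1.isProbabilityMeasure
  constructor
  · have h := (hπ.1.upCrossing_add s t).trans (hπ'.upCrossing_add s t).symm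
    rw [hπ.2] at h
    refine (ENNReal.add_le_add_iff_right (a := min (μ₀ (Iic s)) (μ₁ (Iic t))) ?_).1 ?_
    · exact ((min_le_left _ _).trans_lt (measure_lt_top _ _)).ne
    · rw [h]; gcongr; exact hπ'.box_le s t
  · have h := (hπ.1.downCrossing_add s t).trans (hπ'.downCrossing_add s t).symm
    rw [hπ.2] at h
    refine (ENNReal.add_le_add_iff_right (a := min (μ₀ (Iic t)) (μ₁ (Iic s))) ?_).1 ?_
    · exact ((min_le_left _ _).trans_lt (measure_lt_top _ _)).ne
    · rw [h]; gcongr; exact hπ'.box_le t s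

theorem IsMonotonePlan.transportCost_le {π' : Measure (ℝ × ℝ)} (hπ : IsMonotonePlan μ₀ μ₁ π)
    (hπ' : IsTransferencePlan μ₀ μ₁ π') : transportCost π ≤ transportCost π' := by
  have := hπ.1.isProbabilityMeasure
  have := hπ'.isProbabilityMeasure
  rw [transportCost_eq_lintegral_crossing, transportCost_eq_lintegral_crossing]
  exact lintegral_mono fun p =>
    add_le_add (hπ.crossing_le hπ' _ _).1 (hπ.crossing_le hπ' _ _).2

/-- The comonotone crossing masses are minimal for each interval separately, so equal finite
integrals force equality almost everywhere. -/
theorem ae_box_eq_of_transportCost_le {π' : Measure (ℝ × ℝ)} (hπ : IsMonotonePlan μ₀ μ₁ π)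
    (hπ' : IsTransferencePlan μ₀ μ₁ π') (hfin : transportCost π ≠ ⊤)
    (hle : transportCost π' ≤ transportCost π) :
    ∀ᵐ p : ℝ × ℝ, π' (Iic p.1 ×ˢ Iic p.2) = min (μ₀ (Iic p.1)) (μ₁ (Iic p.2)) := by
  have := hπ.1.isProbabilityMeasure
  have := hπ'.isProbabilityMeasure
  rw [transportCost_eq_lintegral_crossing] at hfin hle
  rw [transportCost_eq_lintegral_crossing] at hle
  have key := ae_eq_of_ae_le_of_lintegral_le
    (ae_of_all volume fun p : ℝ × ℝ => add_le_add
      (hπ.crossing_le hπ' (min p.1 p.2) (max p.1 p.2)).1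
      (hπ.crossing_le hπ' (min p.1 p.2) (max p.1 p.2)).2) hfin
    (measurable_crossing π').aemeasurable hle
  filter_upwards [key] with p hp
  obtain ⟨h1, h2⟩ := hπ.crossing_le hπ' (min p.1 p.2) (max p.1 p.2)
  have e1 : π (upCrossing (min p.1 p.2) (max p.1 p.2)) =
      π' (upCrossing (min p.1 p.2) (max p.1 p.2)) := by
    refine le_antisymm h1 ((ENNReal.add_le_add_iff_right (measure_ne_top π _)).1
      (le_trans (add_le_add le_rfl h2) hp.ge))
  have e2 : π (downCrossing (min p.1 p.2) (max p.1 p.2)) =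
      π' (downCrossing (min p.1 p.2) (max p.1 p.2)) := by
    refine le_antisymm h2 ((ENNReal.add_le_add_iff_left (measure_ne_top π _)).1
      (le_trans (add_le_add h1 le_rfl) hp.ge))
  rw [← hπ.2]
  -- The box at `p` is complementary to up-crossings when `p.1 ≤ p.2` and to down-crossings
  -- otherwise.
  rcases le_total p.1 p.2 with h | h
  · rw [min_eq_left h, max_eq_right h] at e1
    have a := (hπ.1.upCrossing_add p.1 p.2).trans (hπ'.upCrossing_add p.1 p.2).symm
    rw [e1] at a
    exact ((ENNReal.add_right_inj (measure_ne_top π' _)).1 a).symm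
  · rw [min_eq_right h, max_eq_left h] at e2
    have a := (hπ.1.downCrossing_add p.2 p.1).trans (hπ'.downCrossing_add p.2 p.1).symm
    rw [e2] at a
    exact ((ENNReal.add_right_inj (measure_ne_top π' _)).1 a).symm

theorem tendsto_measure_Ioc_zero (μ : Measure ℝ) [IsFiniteMeasure μ] (s : ℝ) :
    Tendsto (fun n : ℕ => μ (Ioc s (s + 1 / ((n : ℝ) + 1)))) atTop (𝓝 0) := by
  have h := tendsto_measure_iInter_atTop (μ := μ)
    (s := fun n : ℕ => Ioc s (s + 1 / ((n : ℝ) + 1)))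
    (fun n => measurableSet_Ioc.nullMeasurableSet)
    (fun m n hmn => Ioc_subset_Ioc_right (by gcongr)) ⟨0, measure_ne_top _ _⟩
  suffices h0 : μ (⋂ n : ℕ, Ioc s (s + 1 / ((n : ℝ) + 1))) = 0 by rwa [h0] at h
  refine measure_mono_null (μ := μ) (t := ∅) ?_ measure_empty
  intro x hx
  simp only [mem_iInter, mem_Ioc] at hx
  obtain ⟨n, hn⟩ := exists_nat_one_div_lt (sub_pos.2 (hx 0).1)
  linarith [(hx n).2]

/-- Right continuity: any small open square just above `(s, t)` contains a good point, whose box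
exceeds the box at `(s, t)` by at most two thin strips of vanishing mass. -/
theorem isMonotonePlan_of_ae_box [IsProbabilityMeasure μ₁] (hπ : IsTransferencePlan μ₀ μ₁ π)
    (h : ∀ᵐ p : ℝ × ℝ, π (Iic p.1 ×ˢ Iic p.2) = min (μ₀ (Iic p.1)) (μ₁ (Iic p.2))) :
    IsMonotonePlan μ₀ μ₁ π := by
  have := hπ.isProbabilityMeasure
  refine ⟨hπ, fun s t => le_antisymm (hπ.box_le s t) ?_⟩
  have bound : ∀ n : ℕ, min (μ₀ (Iic s)) (μ₁ (Iic t)) ≤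
      π (Iic s ×ˢ Iic t) + (μ₀ (Ioc s (s + 1 / ((n : ℝ) + 1))) +
        μ₁ (Ioc t (t + 1 / ((n : ℝ) + 1)))) := by
    intro n
    have hpos : (0 : ℝ) < 1 / ((n : ℝ) + 1) := by positivity
    have hvol : volume (Ioo s (s + 1 / ((n : ℝ) + 1)) ×ˢ Ioo t (t + 1 / ((n : ℝ) + 1))) ≠ 0 := by
      apply (IsOpen.measure_pos _ (isOpen_Ioo.prod isOpen_Ioo) _).ne'
      exact (nonempty_Ioo.2 (by linarith)).prod (nonempty_Ioo.2 (by linarith))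
    obtain ⟨p, hp, hp'⟩ := nonempty_of_measure_ne_zero
      ((measure_inter_conull' (t := {p : ℝ × ℝ | π (Iic p.1 ×ˢ Iic p.2) =
        min (μ₀ (Iic p.1)) (μ₁ (Iic p.2))})
        (measure_mono_null (sdiff_subset_compl _ _) (ae_iff.1 h))).trans_ne hvol)
    calc min (μ₀ (Iic s)) (μ₁ (Iic t)) ≤ min (μ₀ (Iic p.1)) (μ₁ (Iic p.2)) :=
          min_le_min (measure_mono (Iic_subset_Iic.2 hp.1.1.le))
            (measure_mono (Iic_subset_Iic.2 hp.2.1.le))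
      _ = π (Iic p.1 ×ˢ Iic p.2) := hp'.symm
      _ ≤ π (Iic s ×ˢ Iic t ∪ (Prod.fst ⁻¹' Ioc s (s + 1 / ((n : ℝ) + 1)) ∪
            Prod.snd ⁻¹' Ioc t (t + 1 / ((n : ℝ) + 1)))) := by
          apply measure_mono
          rintro z ⟨hz1, hz2⟩
          simp only [mem_Iic] at hz1 hz2
          by_cases a : z.1 ≤ s
          · by_cases b : z.2 ≤ t
            · exact Or.inl ⟨a, b⟩
            · exact Or.inr (Or.inr ⟨not_le.1 b, hz2.trans hp.2.2.le⟩)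
          · exact Or.inr (Or.inl ⟨not_le.1 a, hz1.trans hp.1.2.le⟩)
      _ ≤ _ := by
          rw [← hπ.measure_fst measurableSet_Ioc, ← hπ.measure_snd measurableSet_Ioc]
          exact (measure_union_le _ _).trans (add_le_add le_rfl (measure_union_le _ _))
  have lim := (tendsto_const_nhds (x := π (Iic s ×ˢ Iic t))).add
    ((tendsto_measure_Ioc_zero μ₀ s).add (tendsto_measure_Ioc_zero μ₁ t))
  rw [add_zero, add_zero] at lim
  exact ge_of_tendsto' lim bound

theorem IsMonotonePlan.unique {π' : Measure (ℝ × ℝ)} (hπ : IsMonotonePlan μ₀ μ₁ π)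
    (hπ' : IsMonotonePlan μ₀ μ₁ π') : π' = π := by
  have := hπ.1.isProbabilityMeasure
  have := hπ'.1.isProbabilityMeasure
  refine ext_of_generate_finite (image2 (· ×ˢ ·) (range Iic) (range Iic)) ?_
    (isPiSystem_Iic.prod isPiSystem_Iic) ?_ (by simp)
  · apply generateFrom_eq_prod ?_ ?_ ?_ ?_ |>.symm
    · rw [← borel_eq_generateFrom_Iic, ← BorelSpace.measurable_eq]
    · rw [← borel_eq_generateFrom_Iic, ← BorelSpace.measurable_eq]
    all_goals
      refine ⟨fun n : ℕ => Iic (n : ℝ), fun n => ⟨n, rfl⟩, ?_⟩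
      refine eq_univ_of_forall fun x => mem_iUnion.2 ?_
      exact exists_nat_ge x
  · rintro _ ⟨_, ⟨s, rfl⟩, _, ⟨t, rfl⟩, rfl⟩
    exact (hπ'.2 s t).trans (hπ.2 s t).symm

/-- A comonotone coupling of finite cost is the unique optimal plan. -/
theorem IsMonotonePlan.isOptimalPlan_iff [IsProbabilityMeasure μ₁] {π' : Measure (ℝ × ℝ)} (hπ : IsMonotonePlan μ₀ μ₁ π)
    (hfin : transportCost π ≠ ⊤) : IsOptimalPlan μ₀ μ₁ π' ↔ π' = π := by
  constructor
  · intro h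
    exact hπ.unique (isMonotonePlan_of_ae_box h.1
      (ae_box_eq_of_transportCost_le hπ h.1 hfin (h.2.2 _ hπ.1)))
  · rintro rfl
    exact ⟨hπ.1, hfin, fun π' h' => hπ.transportCost_le h'⟩

end Plans

/-! ### Monotone maps and the monotone rearrangement -/

/-- For monotone `T` the sets `x ≤ a` and `T x ≤ b` are nested up to a null set, so the measure of
their intersection is the smaller of the two. -/
theorem isMonotonePlan_of_monotoneOn {μ : Measure ℝ} [IsProbabilityMeasure μ] {T : ℝ → ℝ}
    (hT : Measurable T) {s : Set ℝ} (hs : ∀ᵐ x ∂μ, x ∈ s) (hmono : MonotoneOn T s) :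
    IsMonotonePlan μ (μ.map T) (μ.map fun x => (x, T x)) := by
  have hg : Measurable fun x => (x, T x) := measurable_id.prodMk hT
  refine ⟨⟨?_, ?_⟩, fun a b => ?_⟩
  · rw [Measure.map_map measurable_fst hg]
    exact Measure.map_id
  · rw [Measure.map_map measurable_snd hg]
    rfl
  · rw [Measure.map_apply hg (measurableSet_Iic.prod measurableSet_Iic),
      Measure.map_apply hT measurableSet_Iic]
    refine le_antisymm (le_min (measure_mono fun x hx => hx.1) (measure_mono fun x hx => hx.2)) ?_
    by_cases h : ∀ x ∈ s, x ≤ a → T x ≤ b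
    · refine (min_le_left _ _).trans (measure_mono_ae ?_)
      filter_upwards [hs] with x hx hxa
      exact ⟨hxa, h x hx hxa⟩
    · push Not at h
      obtain ⟨x₀, hx₀, ha, hb⟩ := h
      refine (min_le_right _ _).trans (measure_mono_ae ?_)
      filter_upwards [hs] with x hx hxb
      refine ⟨?_, hxb⟩
      by_contra hxa
      have hxa' : a < x := not_le.1 hxa
      have hxb' : T x ≤ b := hxb
      linarith [hmono hx₀ hx (ha.trans hxa'.le)]

theorem continuous_cdf {μ : Measure ℝ} [IsProbabilityMeasure μ] (hμ : μ ≪ volume) :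
    Continuous (cdf μ) := by
  refine continuous_iff_continuousAt.2 fun x => ?_
  rw [(monotone_cdf μ).continuousAt_iff_leftLim_eq_rightLim, StieltjesFunction.rightLim_eq]
  have h : (cdf μ).measure {x} = 0 := by rw [measure_cdf]; exact hμ (Real.volume_singleton)
  rw [StieltjesFunction.measure_singleton, ENNReal.ofReal_eq_zero] at h
  exact le_antisymm ((monotone_cdf μ).leftLim_le le_rfl) (by linarith)

theorem exists_cdf_eq {μ : Measure ℝ} [IsProbabilityMeasure μ] (hc : Continuous (cdf μ)) {v : ℝ}
    (hv : v ∈ Ioo (0 : ℝ) 1) : ∃ s, cdf μ s = v := by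
  obtain ⟨a, ha⟩ := ((tendsto_cdf_atBot μ).eventually_le_const hv.1).exists
  obtain ⟨b, hb⟩ := ((tendsto_cdf_atTop μ).eventually_const_le hv.2).exists
  exact mem_range_of_exists_le_of_exists_ge hc ⟨a, ha⟩ ⟨b, hb⟩

/-- A continuous distribution function pushes its own measure to the uniform law. If the two sides
differed, a point `s` where `cdf μ` takes the midpoint value would have `Iic s` comparable with the
sublevel set in the wrong direction. -/
theorem measureReal_cdf_le {μ : Measure ℝ} [IsProbabilityMeasure μ] (hc : Continuous (cdf μ))
    {u : ℝ} (hu : u ∈ Icc (0 : ℝ) 1) : μ.real {x | cdf μ x ≤ u} = u := by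
  have h1 : μ.real {x | cdf μ x ≤ u} ≤ 1 := measureReal_le_one
  have h0 : 0 ≤ μ.real {x | cdf μ x ≤ u} := measureReal_nonneg
  apply le_antisymm
  · by_contra! hlt
    obtain ⟨s, hs⟩ := exists_cdf_eq hc (v := (u + μ.real {x | cdf μ x ≤ u}) / 2)
      ⟨by linarith [hu.1], by linarith [hu.2]⟩
    have : μ.real {x | cdf μ x ≤ u} ≤ μ.real (Iic s) := by
      refine measureReal_mono fun x hx => ?_
      by_contra hxs
      have h2 := monotone_cdf μ (not_le.1 hxs).le
      rw [mem_ofPred_eq] at hx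
      linarith
    rw [← cdf_eq_real, hs] at this
    linarith
  · by_contra! hlt
    obtain ⟨s, hs⟩ := exists_cdf_eq hc (v := (u + μ.real {x | cdf μ x ≤ u}) / 2)
      ⟨by linarith [hu.1], by linarith [hu.2]⟩
    have : μ.real (Iic s) ≤ μ.real {x | cdf μ x ≤ u} := by
      refine measureReal_mono fun x hx => ?_
      have h2 := monotone_cdf μ (mem_Iic.1 hx)
      rw [mem_ofPred_eq]
      linarith
    rw [← cdf_eq_real, hs] at this
    linarith

/-- The open set on which the distribution function of `μ` takes its values in `(0, 1)`. -/
def cdfInterior (μ : Measure ℝ) : Set ℝ := cdf μ ⁻¹' Ioo 0 1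

theorem ae_mem_cdfInterior {μ : Measure ℝ} [IsProbabilityMeasure μ] (hc : Continuous (cdf μ)) :
    ∀ᵐ x ∂μ, x ∈ cdfInterior μ := by
  have h0 := measureReal_cdf_le hc (u := 0) (by simp)
  rw [measureReal_eq_zero_iff] at h0
  have h1 : μ.real {x | cdf μ x < 1} = 1 := by
    refine le_antisymm measureReal_le_one ?_
    by_contra! hlt
    have hnn : 0 ≤ μ.real {x | cdf μ x < 1} := measureReal_nonneg
    have h2 := measureReal_cdf_le hc (u := (1 + μ.real {x | cdf μ x < 1}) / 2)
      ⟨by linarith, by linarith⟩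
    have : μ.real {x | cdf μ x ≤ (1 + μ.real {x | cdf μ x < 1}) / 2} ≤
        μ.real {x | cdf μ x < 1} := by
      refine measureReal_mono fun x hx => ?_
      rw [mem_ofPred_eq] at hx ⊢
      linarith
    linarith
  have h1' : ∀ᵐ x ∂μ, cdf μ x < 1 := by
    have hm : MeasurableSet {x | cdf μ x < 1} :=
      measurableSet_lt hc.measurable measurable_const
    have e : {a | ¬ cdf μ a < 1} = {x | cdf μ x < 1}ᶜ := by ext; simp
    rw [ae_iff, e, prob_compl_eq_zero_iff hm]
    exact (ENNReal.toReal_eq_one_iff _).1 h1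
  have h0' : ∀ᵐ x ∂μ, 0 < cdf μ x := by
    rw [ae_iff]
    simpa using h0
  filter_upwards [h0', h1'] with x a b using ⟨a, b⟩

/-- The Galois connection between quantile and distribution function. Since `u` avoids 0 and 1, the
set is nonempty and bounded below; right continuity makes the infimum attained. -/
theorem sInf_cdf_le_iff {μ : Measure ℝ} {u : ℝ} (hu : u ∈ Ioo (0 : ℝ) 1) (y : ℝ) :
    sInf {y | u ≤ cdf μ y} ≤ y ↔ u ≤ cdf μ y := by
  have hne : {y | u ≤ cdf μ y}.Nonempty :=
    ((tendsto_cdf_atTop μ).eventually_const_le hu.2).exists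
  have hbdd : BddBelow {y | u ≤ cdf μ y} := by
    obtain ⟨b, hb⟩ := ((tendsto_cdf_atBot μ).eventually_lt_const hu.1).exists
    refine ⟨b, fun y hy => ?_⟩
    by_contra hyb
    have h2 := monotone_cdf μ (not_le.1 hyb).le
    rw [mem_ofPred_eq] at hy
    linarith
  refine ⟨fun h => ?_, fun h => csInf_le hbdd h⟩
  have lim : Tendsto (cdf μ) (𝓝[>] y) (𝓝 (cdf μ y)) :=
    ((cdf μ).right_continuous y).mono_left (nhdsWithin_mono _ Ioi_subset_Ici_self)
  refine ge_of_tendsto lim ?_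
  filter_upwards [self_mem_nhdsWithin] with z hz
  obtain ⟨w, hw, hwz⟩ := exists_lt_of_csInf_lt hne (h.trans_lt hz)
  exact le_trans hw (monotone_cdf μ hwz.le)

open Classical in
/-- The monotone rearrangement of `μ₀` onto `μ₁`. -/
noncomputable def rearrangement (μ₀ μ₁ : Measure ℝ) (x : ℝ) : ℝ :=
  if x ∈ cdfInterior μ₀ then sInf {y | cdf μ₀ x ≤ cdf μ₁ y} else 0

theorem rearrangement_le_iff {μ₀ μ₁ : Measure ℝ} {x : ℝ} (hx : x ∈ cdfInterior μ₀) (y : ℝ) :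
    rearrangement μ₀ μ₁ x ≤ y ↔ cdf μ₀ x ≤ cdf μ₁ y := by
  rw [rearrangement, if_pos hx]
  exact sInf_cdf_le_iff hx y

theorem monotoneOn_rearrangement (μ₀ μ₁ : Measure ℝ) :
    MonotoneOn (rearrangement μ₀ μ₁) (cdfInterior μ₀) := fun x hx y hy hxy => by
  rw [rearrangement_le_iff hx]
  exact (monotone_cdf μ₀ hxy).trans ((rearrangement_le_iff hy _).1 le_rfl)

theorem measurableSet_cdfInterior (μ : Measure ℝ) : MeasurableSet (cdfInterior μ) :=
  (monotone_cdf μ).measurable measurableSet_Ioo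

theorem measurable_rearrangement (μ₀ μ₁ : Measure ℝ) : Measurable (rearrangement μ₀ μ₁) := by
  refine measurable_of_Iic fun y => ?_
  have e : rearrangement μ₀ μ₁ ⁻¹' Iic y =
      (cdfInterior μ₀ ∩ cdf μ₀ ⁻¹' Iic (cdf μ₁ y)) ∪ ((cdfInterior μ₀)ᶜ ∩ {_x | 0 ≤ y}) := by
    ext x
    by_cases hx : x ∈ cdfInterior μ₀
    · simp [hx, rearrangement_le_iff hx]
    · simp [hx, rearrangement]
  rw [e]
  exact ((measurableSet_cdfInterior μ₀).inter ((monotone_cdf μ₀).measurable measurableSet_Iic)).union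
    ((measurableSet_cdfInterior μ₀).compl.inter (MeasurableSet.const _))

/-- Points to the left of the quantile have strictly smaller distribution function, so left
continuity of the target excludes a jump. The Jacobian equation for a map that is only monotone
needs this equality. -/
theorem cdf_rearrangement {μ₀ μ₁ : Measure ℝ} (hc : Continuous (cdf μ₁)) {x : ℝ} (hx : x ∈ cdfInterior μ₀) :
    cdf μ₁ (rearrangement μ₀ μ₁ x) = cdf μ₀ x := by
  refine le_antisymm ?_ ((rearrangement_le_iff hx _).1 le_rfl)
  have lim : Tendsto (cdf μ₁) (𝓝[<] rearrangement μ₀ μ₁ x) (𝓝 (cdf μ₁ (rearrangement μ₀ μ₁ x))) :=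
    hc.continuousAt.mono_left nhdsWithin_le_nhds
  refine le_of_tendsto lim ?_
  filter_upwards [self_mem_nhdsWithin] with y hy
  by_contra h
  exact absurd ((rearrangement_le_iff hx y).2 (not_le.1 h).le) (not_le.2 hy)

section Rearrangement

variable {μ₀ μ₁ : Measure ℝ} [IsProbabilityMeasure μ₀] [IsProbabilityMeasure μ₁]

theorem map_rearrangement (hc : Continuous (cdf μ₀)) : μ₀.map (rearrangement μ₀ μ₁) = μ₁ := by
  have := Measure.isProbabilityMeasure_map (μ := μ₀) (measurable_rearrangement μ₀ μ₁).aemeasurable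
  refine Measure.eq_of_cdf _ _ ?_
  ext y
  rw [cdf_eq_real, map_measureReal_apply (measurable_rearrangement μ₀ μ₁) measurableSet_Iic]
  rw [← measureReal_cdf_le hc ⟨cdf_nonneg μ₁ y, cdf_le_one μ₁ y⟩]
  refine measureReal_congr ?_
  filter_upwards [ae_mem_cdfInterior hc] with x hx
  exact propext (rearrangement_le_iff hx y)

theorem isMonotonePlan_rearrangement (hc : Continuous (cdf μ₀)) :
    IsMonotonePlan μ₀ μ₁ (μ₀.map fun x => (x, rearrangement μ₀ μ₁ x)) := by
  have h := isMonotonePlan_of_monotoneOn (measurable_rearrangement μ₀ μ₁)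
    (ae_mem_cdfInterior hc) (monotoneOn_rearrangement μ₀ μ₁)
  rwa [map_rearrangement hc] at h

end Rearrangement

/-! ### Finiteness of the cost -/

theorem transportCost_ne_top {μ₀ μ₁ : Measure ℝ} {π : Measure (ℝ × ℝ)} (h₀ : IsP2 μ₀)
    (h₁ : IsP2 μ₁) (hπ : IsTransferencePlan μ₀ μ₁ π) : transportCost π ≠ ⊤ := by
  obtain ⟨p₀, a, ha⟩ := h₀
  obtain ⟨p₁, b, hb⟩ := h₁
  have := hπ.isProbabilityMeasure
  -- Three-term Cauchy–Schwarz along `z.1, a, b, z.2` would give the constant 3; any finite one will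
  -- do.
  have hle : ∀ z : ℝ × ℝ, edist z.1 z.2 ^ 2 ≤
      4 * (edist z.1 a ^ 2 + edist z.2 b ^ 2 + edist a b ^ 2) := by
    intro z
    simp only [edist_dist, ← ENNReal.ofReal_pow dist_nonneg]
    rw [← ENNReal.ofReal_add (by positivity) (by positivity),
      ← ENNReal.ofReal_add (by positivity) (by positivity),
      show (4 : ℝ≥0∞) = ENNReal.ofReal 4 by simp, ← ENNReal.ofReal_mul (by norm_num)]
    apply ENNReal.ofReal_le_ofReal
    simp only [Real.dist_eq, sq_abs]
    nlinarith [sq_nonneg ((z.1 - a) + (z.2 - b)), sq_nonneg ((z.1 - a) - (a - b)),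
      sq_nonneg ((z.2 - b) + (a - b))]
  have m1 : Measurable fun z : ℝ × ℝ => edist z.1 a ^ 2 := by fun_prop
  have m2 : Measurable fun z : ℝ × ℝ => edist z.2 b ^ 2 := by fun_prop
  have e1 : ∫⁻ z, edist z.1 a ^ 2 ∂π = ∫⁻ x, edist x a ^ 2 ∂μ₀ := by
    rw [← hπ.1, lintegral_map (by fun_prop) measurable_fst]
  have e2 : ∫⁻ z, edist z.2 b ^ 2 ∂π = ∫⁻ x, edist x b ^ 2 ∂μ₁ := by
    rw [← hπ.2, lintegral_map (by fun_prop) measurable_snd]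
  refine ((lintegral_mono hle).trans_lt ?_).ne
  rw [lintegral_const_mul' _ _ (by simp), lintegral_add_right _ measurable_const,
    lintegral_add_left m1, e1, e2, lintegral_const, measure_univ, mul_one]
  exact ENNReal.mul_lt_top (by simp) (ENNReal.add_lt_top.2 ⟨ENNReal.add_lt_top.2 ⟨ha, hb⟩,
    ENNReal.pow_lt_top (edist_lt_top _ _)⟩)

theorem IsPc.isP2 {μ : Measure ℝ} (h : IsPc μ) : IsP2 μ := by
  have := h.1
  refine ⟨h.1, 0, ?_⟩
  obtain ⟨R, hR⟩ := h.2.subset_closedBall 0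
  calc ∫⁻ x, edist x 0 ^ 2 ∂μ ≤ ∫⁻ _, ENNReal.ofReal R ^ 2 ∂μ := by
        refine lintegral_mono_ae ?_
        filter_upwards [Measure.support_mem_ae (μ := μ)] with x hx
        gcongr
        rw [edist_dist]
        exact ENNReal.ofReal_le_ofReal (hR hx)
    _ < ⊤ := by simp

/-! ### Expanding maps, Jacobian equation -/

/-- On `s` the map has a Lipschitz inverse, so preimages of null sets are null for one-dimensional
Hausdorff measure, which is Lebesgue measure on the line. -/
theorem map_absolutelyContinuous_of_expanding {μ : Measure ℝ} (hμ : μ ≪ volume) {T : ℝ → ℝ}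
    (hT : Measurable T) {s : Set ℝ} (hs : ∀ᵐ x ∂μ, x ∈ s) {c : ℝ} (hc : 0 < c)
    (h : ∀ x ∈ s, ∀ y ∈ s, c * |x - y| ≤ |T x - T y|) : μ.map T ≪ volume := by
  refine Measure.AbsolutelyContinuous.mk fun A hA hA0 => ?_
  rw [Measure.map_apply hT hA, ← measure_inter_conull' (t := s) (measure_mono_null
    (sdiff_subset_compl _ _) (ae_iff.1 hs))]
  apply hμ
  have hanti : AntilipschitzWith (Real.toNNReal c⁻¹) (s.domRestrict T) := by
    refine AntilipschitzWith.of_le_mul_dist fun x y => ?_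
    rw [Real.coe_toNNReal _ (inv_nonneg.2 hc.le), ← div_eq_inv_mul, le_div_iff₀ hc, mul_comm]
    exact h x x.2 y y.2
  have h1 := hanti.hausdorffMeasure_preimage_le (d := 1) zero_le_one A
  rw [hausdorffMeasure_real, hA0, mul_zero, nonpos_iff_eq_zero] at h1
  -- The preimage was measured inside the subtype `s`; the isometric inclusion moves its nullity to
  -- the line.
  have h2 := (isometry_subtype_coe (s := s)).hausdorffMeasure_image (d := 1)
    (Or.inl zero_le_one) (s.domRestrict T ⁻¹' A)
  rw [h1, hausdorffMeasure_real] at h2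
  refine measure_mono_null ?_ h2
  rintro x ⟨hx, hxs⟩
  exact ⟨⟨x, hxs⟩, hx, rfl⟩

theorem cdf_map_of_strictMonoOn {μ : Measure ℝ} [IsProbabilityMeasure μ] {T : ℝ → ℝ}
    (hT : Measurable T) {s : Set ℝ} (hs : ∀ᵐ x ∂μ, x ∈ s) (hmono : StrictMonoOn T s) {x : ℝ}
    (hx : x ∈ s) : cdf (μ.map T) (T x) = cdf μ x := by
  have := Measure.isProbabilityMeasure_map (μ := μ) hT.aemeasurable
  rw [cdf_eq_real, cdf_eq_real, map_measureReal_apply hT measurableSet_Iic]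
  refine measureReal_congr ?_
  filter_upwards [hs] with y hy
  exact propext (hmono.le_iff_le hy hx)

/-- Differentiate `cdf (μ₀.map T) ∘ T = cdf μ₀` by the chain rule; both distribution functions have
the density as derivative almost everywhere. Openness of `s` makes the identity hold near the point.
-/
theorem ae_rnDeriv_eq_mul_deriv {μ₀ : Measure ℝ} [IsProbabilityMeasure μ₀]
    (h₀ : μ₀ ≪ volume) {T : ℝ → ℝ} (hT : Measurable T) (h₁ : μ₀.map T ≪ volume) {s : Set ℝ}
    (hso : IsOpen s) (hs : ∀ᵐ x ∂μ₀, x ∈ s) (hcdf : ∀ x ∈ s, cdf (μ₀.map T) (T x) = cdf μ₀ x)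
    {T' : ℝ → ℝ} (hd : ∀ᵐ x ∂μ₀, HasDerivAt T (T' x) x) :
    ∀ᵐ x ∂μ₀, (μ₀.rnDeriv volume x).toReal =
      ((μ₀.map T).rnDeriv volume (T x)).toReal * T' x := by
  have := Measure.isProbabilityMeasure_map (μ := μ₀) hT.aemeasurable
  have d0 := h₀.ae_le (cdf μ₀).ae_hasDerivAt
  have d1 := ae_of_ae_map hT.aemeasurable (h₁.ae_le (cdf (μ₀.map T)).ae_hasDerivAt)
  rw [measure_cdf] at d0 d1
  filter_upwards [hs, hd, d0, d1] with x hx a b c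
  have e : (cdf (μ₀.map T)) ∘ T =ᶠ[𝓝 x] cdf μ₀ :=
    Filter.eventually_of_mem (hso.mem_nhds hx) hcdf
  exact b.unique ((c.comp x a).congr_of_eventuallyEq e.symm)

/-! ### Distortion coefficients -/

theorem continuous_sFun (κ : ℝ) : Continuous (sFun κ) := by
  unfold sFun
  split_ifs <;> fun_prop

theorem sFun_pos {K M θ : ℝ} (hM : 0 < M) (hθ : 0 < θ) (h : K * θ ^ 2 < Real.pi ^ 2 * M) :
    0 < sFun (K / M) θ := by
  unfold sFun
  split_ifs with h1 h2
  · have hs : 0 < √(K / M) := Real.sqrt_pos.2 h1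
    refine mul_pos (by positivity) (Real.sin_pos_of_pos_of_lt_pi (by positivity) ?_)
    refine lt_of_pow_lt_pow_left₀ 2 Real.pi_pos.le ?_
    rw [mul_pow, Real.sq_sqrt h1.le, div_mul_eq_mul_div, div_lt_iff₀ hM]
    exact h
  · exact hθ
  · have h3 : 0 < -(K / M) := by
      rcases lt_trichotomy (K / M) 0 with h | h | h
      · linarith
      · exact absurd h h2
      · exact absurd h h1
    have hs : 0 < √(-(K / M)) := Real.sqrt_pos.2 h3
    exact mul_pos (by positivity) (Real.sinh_pos_iff.2 (by positivity))

theorem curvature_lt_of_mul {K M t θ : ℝ} (hM : 0 < M) (ht0 : 0 < t) (ht1 : t < 1)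
    (h : K * θ ^ 2 ≤ Real.pi ^ 2 * M) : K * (t * θ) ^ 2 < Real.pi ^ 2 * M := by
  have hp : 0 < Real.pi ^ 2 * M := by have := Real.pi_pos; positivity
  have ht : t ^ 2 < 1 := by nlinarith
  rw [mul_pow, ← mul_assoc, mul_comm K, mul_assoc]
  rcases le_or_gt (K * θ ^ 2) 0 with hK | hK
  · nlinarith [sq_nonneg t]
  · nlinarith

theorem sigma_pos {K M t θ : ℝ} (hM : 0 < M) (ht0 : 0 < t) (ht1 : t < 1) (hθ : 0 ≤ θ) :
    sigma K M t θ ≠ 0 := by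
  unfold sigma
  split_ifs with h1 h2
  · simp
  · simpa using ht0
  · have hθ' : 0 < θ := lt_of_le_of_ne hθ (Ne.symm h2)
    rw [not_le] at h1
    simpa using div_pos (sFun_pos hM (mul_pos ht0 hθ') (curvature_lt_of_mul hM ht0 ht1 h1.le))
      (sFun_pos hM hθ' h1)

theorem sigma_eq_top_iff {K M t θ : ℝ} :
    sigma K M t θ = ⊤ ↔ Real.pi ^ 2 * M ≤ K * θ ^ 2 := by
  unfold sigma
  split_ifs with h1 h2 <;> simp [h1]

/-- The delicate case is the critical length: from the left the denominator tends to 0 through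
positive values while the numerator stays positive, so the quotient blows up to the prescribed value
`⊤`. -/
theorem continuousAt_sigma {K M t θ : ℝ} (hM : 0 < M) (ht0 : 0 < t) (ht1 : t < 1) (hθ : 0 < θ) :
    ContinuousAt (sigma K M t) θ := by
  have hc : Continuous fun x : ℝ => K * x ^ 2 := by fun_prop
  have hnum : Continuous fun x : ℝ => sFun (K / M) (t * x) :=
    (continuous_sFun _).comp (by fun_prop)
  rcases lt_trichotomy (K * θ ^ 2) (Real.pi ^ 2 * M) with h | h | h
  · have e : sigma K M t =ᶠ[𝓝 θ]
        fun x => ENNReal.ofReal (sFun (K / M) (t * x) / sFun (K / M) x) := by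
      filter_upwards [hc.continuousAt.eventually_lt_const h, lt_mem_nhds hθ] with x h1 h2
      rw [sigma, if_neg (not_le.2 h1), if_neg h2.ne']
    refine ContinuousAt.congr ?_ e.symm
    exact ENNReal.continuous_ofReal.continuousAt.comp
      (hnum.continuousAt.div (continuous_sFun _).continuousAt (sFun_pos hM hθ h).ne')
  · have hK : 0 < K := by
      by_contra hK
      have := Real.pi_pos
      have h1 : 0 < Real.pi ^ 2 * M := by positivity
      nlinarith [sq_nonneg θ]
    have htop : sigma K M t θ = ⊤ := sigma_eq_top_iff.2 h.ge
    rw [ContinuousAt, htop, ← nhdsLT_sup_nhdsGE, tendsto_sup]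
    constructor
    · have e : (fun x => ENNReal.ofReal (sFun (K / M) (t * x) / sFun (K / M) x)) =ᶠ[𝓝[<] θ]
          sigma K M t := by
        filter_upwards [self_mem_nhdsWithin, nhdsWithin_le_nhds (lt_mem_nhds hθ)] with x h1 h2
        have h1' : x < θ := h1
        have h3 : K * x ^ 2 < Real.pi ^ 2 * M := by
          rw [← h]
          gcongr
        rw [sigma, if_neg (not_le.2 h3), if_neg h2.ne']
      refine Tendsto.congr' e (ENNReal.tendsto_ofReal_atTop.comp ?_)
      simp only [div_eq_mul_inv]
      refine Tendsto.pos_mul_atTop (sFun_pos hM (mul_pos ht0 hθ)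
        (curvature_lt_of_mul hM ht0 ht1 h.le)) (hnum.continuousAt.mono_left nhdsWithin_le_nhds) ?_
      refine tendsto_inv_nhdsGT_zero.comp (tendsto_nhdsWithin_iff.2 ⟨?_, ?_⟩)
      · have h0 : sFun (K / M) θ = 0 := by
          have h1 : √(K / M) * θ = Real.pi := by
            rw [← Real.sqrt_sq hθ.le, ← Real.sqrt_mul (by positivity), div_mul_eq_mul_div, h,
              mul_div_assoc, div_self hM.ne', mul_one, Real.sqrt_sq Real.pi_pos.le]
          rw [sFun, if_pos (by positivity), h1, Real.sin_pi, mul_zero]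
        rw [← h0]
        exact (continuous_sFun _).continuousAt.mono_left nhdsWithin_le_nhds
      · filter_upwards [self_mem_nhdsWithin, nhdsWithin_le_nhds (lt_mem_nhds hθ)] with x h1 h2
        have h1' : x < θ := h1
        refine sFun_pos hM h2 ?_
        rw [← h]
        gcongr
    · refine tendsto_const_nhds.congr' ?_
      filter_upwards [self_mem_nhdsWithin] with x hx
      have hx' : θ ≤ x := hx
      refine (sigma_eq_top_iff.2 ?_).symm
      rw [← h]
      gcongr
  · have e : sigma K M t =ᶠ[𝓝 θ] fun _ => ⊤ := by
      filter_upwards [hc.continuousAt.eventually_const_lt h] with x h1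
      exact sigma_eq_top_iff.2 h1.le
    exact continuousAt_const.congr e.symm

theorem continuousAt_tau {K N t θ : ℝ} (hN : 1 < N) (ht0 : 0 < t) (ht1 : t < 1) (hθ : 0 < θ) :
    ContinuousAt (tau K N t) θ :=
  ENNReal.Tendsto.const_mul (ENNReal.continuous_rpow_const.continuousAt.comp
    (continuousAt_sigma (by linarith) ht0 ht1 hθ))
    (Or.inr (ENNReal.rpow_ne_top_of_nonneg (by positivity) (by simp)))

/-! ### The inequality along a transport map -/

/-- The inequality between the values of the density along the interpolation of a transport map
whose derivative is `l`. -/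
def TangentIneq (Q K N t θ : ℝ) (l h₀ h₁ hₜ : ℝ≥0∞) : Prop :=
  (ENNReal.ofReal Q ^ (1 / N))⁻¹ *
      (tau K N (1 - t) θ * h₀ ^ (1 / N) + tau K N t θ * (l * h₁) ^ (1 / N)) ≤
    ((ENNReal.ofReal (1 - t) + ENNReal.ofReal t * l) * hₜ) ^ (1 / N)

/-- The inequality that defines a one-dimensional `QCD(Q,K,N)` density. -/
def DensityIneq (Q K N t θ : ℝ) (h₀ h₁ hₜ : ℝ≥0∞) : Prop :=
  (ENNReal.ofReal Q ^ (1 / (N - 1)))⁻¹ *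
      (sigma K (N - 1) (1 - t) θ * h₀ ^ (1 / (N - 1)) +
        sigma K (N - 1) t θ * h₁ ^ (1 / (N - 1))) ≤ hₜ ^ (1 / (N - 1))

theorem hoelder_two (a₀ a₁ b₀ b₁ : ℝ≥0∞) {N : ℝ} (hN : 1 < N) :
    a₀ ^ (1 / N) * b₀ ^ (1 - 1 / N) + a₁ ^ (1 / N) * b₁ ^ (1 - 1 / N) ≤
      (a₀ + a₁) ^ (1 / N) * (b₀ + b₁) ^ (1 - 1 / N) := by
  have hN0 : N ≠ 0 := by linarith
  have hN1 : N - 1 ≠ 0 := by linarith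
  have hpq : N.HolderConjugate (N / (N - 1)) := Real.HolderConjugate.conjExponent hN
  have h := ENNReal.inner_le_Lp_mul_Lq Finset.univ ![a₀ ^ (1 / N), a₁ ^ (1 / N)]
    ![b₀ ^ (1 - 1 / N), b₁ ^ (1 - 1 / N)] hpq
  have e1 : 1 / N * N = 1 := by field_simp
  have e2 : (1 - 1 / N) * (N / (N - 1)) = 1 := by field_simp
  have e3 : 1 / (N / (N - 1)) = 1 - 1 / N := by field_simp
  simpa only [Fin.sum_univ_two, Matrix.cons_val_zero, Matrix.cons_val_one, ← ENNReal.rpow_mul, e1,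
    e2, e3, ENNReal.rpow_one] using h

theorem sigma_mul_rpow (s x : ℝ≥0∞) {N : ℝ} (hN : 1 < N) :
    (s * x ^ (1 / (N - 1))) ^ (1 - 1 / N) = s ^ (1 - 1 / N) * x ^ (1 / N) := by
  have hN1 : N - 1 ≠ 0 := by linarith
  have hN0 : N ≠ 0 := by linarith
  have h1 : 0 ≤ 1 - 1 / N := by
    rw [sub_nonneg, div_le_one (by linarith)]
    exact hN.le
  rw [ENNReal.mul_rpow_of_nonneg _ _ h1, ← ENNReal.rpow_mul]
  congr 2
  field_simp

/-- This is the Hölder form `∑ aᵢ^{1/N} bᵢ^{1-1/N}` with `a = (1-t, t l)` and `bᵢ = σ hᵢ^{1/(N-1)}`;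
the exponents match because `(1 - 1/N) / (N-1) = 1/N`. -/
theorem tangentIneq_lhs (K N t θ : ℝ) (l h₀ h₁ : ℝ≥0∞) (hN : 1 < N) :
    tau K N (1 - t) θ * h₀ ^ (1 / N) + tau K N t θ * (l * h₁) ^ (1 / N) =
      ENNReal.ofReal (1 - t) ^ (1 / N) *
          (sigma K (N - 1) (1 - t) θ * h₀ ^ (1 / (N - 1))) ^ (1 - 1 / N) +
        (ENNReal.ofReal t * l) ^ (1 / N) *
          (sigma K (N - 1) t θ * h₁ ^ (1 / (N - 1))) ^ (1 - 1 / N) := by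
  have hp : 0 ≤ 1 / N := by positivity
  rw [sigma_mul_rpow _ _ hN, sigma_mul_rpow _ _ hN, tau, tau, ENNReal.mul_rpow_of_nonneg _ _ hp,
    ENNReal.mul_rpow_of_nonneg _ _ hp]
  ring

/-- Raise the density inequality to the power `1 - 1/N` and apply Hölder; the other Hölder factor is
exactly the derivative of the interpolation. -/
theorem DensityIneq.tangentIneq {Q K N t θ : ℝ} {h₀ h₁ hₜ : ℝ≥0∞} (hN : 1 < N)
    (h : DensityIneq Q K N t θ h₀ h₁ hₜ) (l : ℝ≥0∞) : TangentIneq Q K N t θ l h₀ h₁ hₜ := by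
  have hN0 : N ≠ 0 := by linarith
  have hN1 : N - 1 ≠ 0 := by linarith
  have hp : 0 ≤ 1 / N := by positivity
  have h1 : 0 ≤ 1 - 1 / N := by
    rw [sub_nonneg, div_le_one (by linarith)]
    exact hN.le
  have e : 1 / (N - 1) * (1 - 1 / N) = 1 / N := by field_simp
  have h2 := ENNReal.rpow_le_rpow h h1
  rw [ENNReal.mul_rpow_of_nonneg _ _ h1, ENNReal.inv_rpow, ← ENNReal.rpow_mul,
    ← ENNReal.rpow_mul, e] at h2
  rw [TangentIneq, tangentIneq_lhs _ _ _ _ _ _ _ hN, ENNReal.mul_rpow_of_nonneg _ hₜ hp]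
  calc _ ≤ (ENNReal.ofReal Q ^ (1 / N))⁻¹ * ((ENNReal.ofReal (1 - t) + ENNReal.ofReal t * l) ^
        (1 / N) * (sigma K (N - 1) (1 - t) θ * h₀ ^ (1 / (N - 1)) +
          sigma K (N - 1) t θ * h₁ ^ (1 / (N - 1))) ^ (1 - 1 / N)) := by
        gcongr
        exact hoelder_two _ _ _ _ hN
    _ = (ENNReal.ofReal (1 - t) + ENNReal.ofReal t * l) ^ (1 / N) *
          ((ENNReal.ofReal Q ^ (1 / N))⁻¹ *
          (sigma K (N - 1) (1 - t) θ * h₀ ^ (1 / (N - 1)) +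
          sigma K (N - 1) t θ * h₁ ^ (1 / (N - 1))) ^ (1 - 1 / N)) := by ring
    _ ≤ _ := by gcongr

/-- Optimizing over the derivative of the transport map recovers the density inequality. -/
theorem densityIneq_of_tangentIneq {Q K N t θ : ℝ} {h₀ h₁ hₜ : ℝ≥0∞} (hN : 1 < N) (ht0 : 0 < t)
    (ht1 : t < 1) (hθ : 0 ≤ θ) (hfin : K * θ ^ 2 < Real.pi ^ 2 * (N - 1))
    (h₀0 : h₀ ≠ 0) (h₀t : h₀ ≠ ⊤) (h₁0 : h₁ ≠ 0) (h₁t : h₁ ≠ ⊤)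
    (h : ∀ l : ℝ≥0∞, l ≠ 0 → l ≠ ⊤ → TangentIneq Q K N t θ l h₀ h₁ hₜ) :
    DensityIneq Q K N t θ h₀ h₁ hₜ := by
  have hN0 : 0 < N := by linarith
  have hN1 : 0 < N - 1 := by linarith
  have hp : 0 ≤ 1 / N := by positivity
  have hpos : ∀ x : ℝ≥0∞, x ≠ 0 → x ≠ ⊤ → ∀ u : ℝ, 0 < u → u < 1 →
      sigma K (N - 1) u θ * x ^ (1 / (N - 1)) ≠ 0 ∧
        sigma K (N - 1) u θ * x ^ (1 / (N - 1)) ≠ ⊤ := by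
    intro x hx0 hxt u hu0 hu1
    constructor
    · refine mul_ne_zero (sigma_pos hN1 hu0 hu1 hθ) ?_
      simp [ENNReal.rpow_eq_zero_iff, hx0, hxt]
    · refine ENNReal.mul_ne_top ?_ (ENNReal.rpow_ne_top_of_nonneg (by positivity) hxt)
      rw [Ne, sigma_eq_top_iff, not_le]
      exact hfin
  obtain ⟨b00, b0t⟩ := hpos h₀ h₀0 h₀t (1 - t) (by linarith) (by linarith)
  obtain ⟨b10, b1t⟩ := hpos h₁ h₁0 h₁t t ht0 ht1
  rw [DensityIneq]
  simp only [TangentIneq, tangentIneq_lhs _ _ _ _ _ _ _ hN] at h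
  generalize sigma K (N - 1) (1 - t) θ * h₀ ^ (1 / (N - 1)) = b₀ at *
  generalize sigma K (N - 1) t θ * h₁ ^ (1 / (N - 1)) = b₁ at *
  have ht : ENNReal.ofReal t ≠ 0 := by simpa using ht0
  have ht' : ENNReal.ofReal (1 - t) ≠ 0 := by simpa using ht1
  -- With `l = c b₁ / t` the vector `(1-t, t l)` equals `c (b₀, b₁)`, the equality case of Hölder.
  set c := ENNReal.ofReal (1 - t) / b₀ with hc
  have hc0 : c ≠ 0 := ENNReal.div_ne_zero.2 ⟨ht', b0t⟩
  have hct : c ≠ ⊤ := ENNReal.div_ne_top (by simp) b00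
  have e0 : ENNReal.ofReal (1 - t) = c * b₀ := (ENNReal.div_mul_cancel b00 b0t).symm
  have h1 := h (c * b₁ / ENNReal.ofReal t)
    (ENNReal.div_ne_zero.2 ⟨mul_ne_zero hc0 b10, by simp⟩)
    (ENNReal.div_ne_top (ENNReal.mul_ne_top hct b1t) ht)
  rw [ENNReal.mul_div_cancel ht (by simp), e0, ← mul_add, ENNReal.mul_rpow_of_nonneg _ _ hp,
    ENNReal.mul_rpow_of_nonneg _ _ hp, ENNReal.mul_rpow_of_nonneg _ _ hp,
    ENNReal.mul_rpow_of_nonneg _ _ hp] at h1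
  have split : ∀ b : ℝ≥0∞, b ≠ 0 → b ≠ ⊤ → b ^ (1 / N) * b ^ (1 - 1 / N) = b := by
    intro b hb0 hbt
    rw [← ENNReal.rpow_add _ _ hb0 hbt]
    simp
  have B0 : b₀ + b₁ ≠ 0 := by simp [b00]
  have Bt : b₀ + b₁ ≠ ⊤ := ENNReal.add_ne_top.2 ⟨b0t, b1t⟩
  rw [mul_assoc, split _ b00 b0t, mul_assoc, split _ b10 b1t, ← mul_add] at h1
  nth_rewrite 1 [← split _ B0 Bt] at h1
  -- Both sides contain `(c (b₀ + b₁))^{1/N}`, which is positive and finite; cancelling it leaves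
  -- the density inequality to the power `1 - 1/N`.
  have h2 : (c ^ (1 / N) * (b₀ + b₁) ^ (1 / N)) *
      ((ENNReal.ofReal Q ^ (1 / N))⁻¹ * (b₀ + b₁) ^ (1 - 1 / N)) ≤
      (c ^ (1 / N) * (b₀ + b₁) ^ (1 / N)) * hₜ ^ (1 / N) := by
    refine le_trans (le_of_eq ?_) h1
    ring
  rw [ENNReal.mul_le_mul_iff_right] at h2
  · have e1 : 1 / N * (N / (N - 1)) = 1 / (N - 1) := by field_simp
    have e2 : (1 - 1 / N) * (N / (N - 1)) = 1 := by field_simp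
    have hq : 0 ≤ N / (N - 1) := by positivity
    have h3 := ENNReal.rpow_le_rpow h2 hq
    rwa [ENNReal.mul_rpow_of_nonneg _ _ hq, ENNReal.inv_rpow, ← ENNReal.rpow_mul,
      ← ENNReal.rpow_mul, ← ENNReal.rpow_mul, e1, e2, ENNReal.rpow_one] at h3
  · refine mul_ne_zero ?_ ?_ <;> simp [ENNReal.rpow_eq_zero_iff, hc0, hct, b00, b0t, b1t]
  · exact ENNReal.mul_ne_top (ENNReal.rpow_ne_top_of_nonneg hp hct)
      (ENNReal.rpow_ne_top_of_nonneg hp Bt)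

/-! ### The measure with density `h` -/

section Density

variable {h : ℝ → ℝ≥0}

theorem densityMeasure_ac (h : ℝ → ℝ≥0) : densityMeasure h ≪ volume :=
  withDensity_absolutelyContinuous _ _

theorem sigmaFinite_densityMeasure (h : ℝ → ℝ≥0) :
    SigmaFinite (densityMeasure h) := by
  unfold densityMeasure
  exact SigmaFinite.withDensity_of_ne_top (ae_of_all _ fun _ => ENNReal.coe_ne_top)

theorem densityMeasure_eq_zero_iff (hh : AEMeasurable h volume) {s : Set ℝ} :
    densityMeasure h s = 0 ↔ volume ({x | h x ≠ 0} ∩ s) = 0 := by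
  rw [densityMeasure, withDensity_apply_eq_zero' hh.coe_nnreal_ennreal]
  simp

theorem ae_densityMeasure_ne_zero (hh : AEMeasurable h volume) :
    ∀ᵐ x ∂densityMeasure h, h x ≠ 0 := by
  rw [ae_iff, densityMeasure_eq_zero_iff hh]
  convert measure_empty (μ := (volume : Measure ℝ))
  ext x
  simp

theorem absolutelyContinuous_densityMeasure (hh : AEMeasurable h volume) {μ : Measure ℝ}
    (hμ : μ ≪ volume) (hpos : ∀ᵐ x ∂μ, h x ≠ 0) : μ ≪ densityMeasure h := by
  intro s hs
  rw [densityMeasure_eq_zero_iff hh] at hs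
  have h1 := hμ hs
  rw [ae_iff] at hpos
  refine measure_mono_null ?_ (measure_union_null h1 hpos)
  intro x hx
  by_cases h0 : h x = 0
  · exact Or.inr (not_not.2 h0)
  · exact Or.inl ⟨h0, hx⟩

/-- Besides the chain rule for densities, this records that the factors are nonzero and finite, so
that negative powers and cancellation are legitimate in `[0,∞]`. -/
theorem ae_rnDeriv_volume (hh : AEMeasurable h volume) {μ : Measure ℝ} [IsFiniteMeasure μ]
    (hμ : μ ≪ densityMeasure h) :
    ∀ᵐ x ∂μ, μ.rnDeriv volume x = μ.rnDeriv (densityMeasure h) x * h x ∧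
      μ.rnDeriv (densityMeasure h) x ≠ 0 ∧ μ.rnDeriv (densityMeasure h) x ≠ ⊤ ∧ h x ≠ 0 := by
  have := sigmaFinite_densityMeasure h
  have hv := hμ.trans (densityMeasure_ac h)
  have e1 := hv.ae_le (Measure.rnDeriv_mul_rnDeriv (κ := (volume : Measure ℝ)) hμ)
  have e2 := hv.ae_le (Measure.rnDeriv_withDensity₀ volume hh.coe_nnreal_ennreal)
  have e3 := hμ.ae_le (Measure.rnDeriv_ne_top μ (densityMeasure h))
  filter_upwards [e1, e2, e3, Measure.rnDeriv_pos hμ, hμ.ae_le (ae_densityMeasure_ne_zero hh)]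
    with x a b c d e
  refine ⟨?_, d.ne', c, e⟩
  rw [← a, Pi.mul_apply]
  congr 1

/-- Isolates `(f₀ ^ p)⁻¹`, the factor common to the terms at times 0, `t` and 1, which can then be
cancelled. -/
theorem rpow_neg_eq_of_jacobian {ρ f f₀ l : ℝ≥0∞} {k : ℝ≥0} {p : ℝ} (hp : 0 ≤ p)
    (hf : f = ρ * k) (hρ0 : ρ ≠ 0) (hρt : ρ ≠ ⊤) (hk : k ≠ 0) (hl0 : l ≠ 0) (hlt : l ≠ ⊤)
    (h₀ : f₀ = f * l) : ρ ^ (-p) = (l * k) ^ p * (f₀ ^ p)⁻¹ := by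
  have hk0 : (k : ℝ≥0∞) ≠ 0 := by simpa using hk
  have hlk0 : l * k ≠ 0 := mul_ne_zero hl0 hk0
  have hlkt : l * k ≠ ⊤ := ENNReal.mul_ne_top hlt (by simp)
  have e : f₀ = ρ * (l * k) := by rw [h₀, hf]; ring
  rw [e, ENNReal.mul_rpow_of_nonneg ρ _ hp, ENNReal.rpow_neg, ENNReal.mul_inv, mul_left_comm,
    ENNReal.mul_inv_cancel, mul_one]
  · simp [ENNReal.rpow_eq_zero_iff, hlk0, hlkt]
  · exact ENNReal.rpow_ne_top_of_nonneg hp hlkt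
  · left; simp [ENNReal.rpow_eq_zero_iff, hρ0, hρt]
  · left; exact ENNReal.rpow_ne_top_of_nonneg hp hρt

theorem ennreal_jacobian {f₀ f₁ : ℝ≥0∞} {l : ℝ} (h00 : f₀ ≠ 0) (h0t : f₀ ≠ ⊤) (h1t : f₁ ≠ ⊤)
    (h : f₀.toReal = f₁.toReal * l) : 0 < l ∧ f₀ = f₁ * ENNReal.ofReal l := by
  have hp : 0 < f₁.toReal * l := h ▸ ENNReal.toReal_pos h00 h0t
  have hl : 0 < l := pos_of_mul_pos_right hp ENNReal.toReal_nonneg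
  refine ⟨hl, ?_⟩
  rw [← ENNReal.ofReal_toReal h0t, h, ENNReal.ofReal_mul ENNReal.toReal_nonneg,
    ENNReal.ofReal_toReal h1t]

/-- The interpolation between the identity and `T`. -/
def interpolate (T : ℝ → ℝ) (t x : ℝ) : ℝ := (1 - t) * x + t * T x

theorem interpolate_expanding {T : ℝ → ℝ} {s : Set ℝ} (hmono : MonotoneOn T s) {t : ℝ}
    (ht0 : 0 ≤ t) : ∀ x ∈ s, ∀ y ∈ s, (1 - t) * |x - y| ≤ |interpolate T t x - interpolate T t y| := by
  intro x hx y hy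
  unfold interpolate
  rcases le_total x y with h | h
  · have := mul_nonneg ht0 (sub_nonneg.2 (hmono hx hy h))
    rw [abs_of_nonpos (sub_nonpos.2 h), abs_sub_comm]
    refine le_trans ?_ (le_abs_self _)
    linarith
  · have := mul_nonneg ht0 (sub_nonneg.2 (hmono hy hx h))
    rw [abs_of_nonneg (sub_nonneg.2 h)]
    refine le_trans ?_ (le_abs_self _)
    linarith

theorem strictMonoOn_interpolate {T : ℝ → ℝ} {s : Set ℝ} (hmono : MonotoneOn T s) {t : ℝ}
    (ht0 : 0 ≤ t) (ht1 : t < 1) : StrictMonoOn (interpolate T t) s := by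
  intro x hx y hy hxy
  have h1 := mul_nonneg ht0 (sub_nonneg.2 (hmono hx hy hxy.le))
  have h2 := mul_pos (sub_pos.2 ht1) (sub_pos.2 hxy)
  unfold interpolate
  linarith

theorem measurable_interpolate {T : ℝ → ℝ} (hT : Measurable T) (t : ℝ) :
    Measurable (interpolate T t) :=
  (measurable_id.const_mul _).add (hT.const_mul _)

/-- Along a monotone transport map the `QCD` inequality for the densities of the interpolated
measures is the inequality `TangentIneq` for `h` and the derivative of the map. -/
theorem ae_qcd_iff_tangentIneq (hh : AEMeasurable h volume) {μ : Measure ℝ}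
    [IsProbabilityMeasure μ] (hμ : μ ≪ densityMeasure h) {T : ℝ → ℝ} (hT : Measurable T)
    {s : Set ℝ} (hso : IsOpen s) (hs : ∀ᵐ x ∂μ, x ∈ s) (hmono : MonotoneOn T s)
    (hcdf : ∀ x ∈ s, cdf (μ.map T) (T x) = cdf μ x) (hμT : μ.map T ≪ densityMeasure h) {t : ℝ}
    (ht0 : 0 < t) (ht1 : t < 1) (hμt : μ.map (interpolate T t) ≪ densityMeasure h) {Q K N : ℝ}
    (hN : 1 < N) :
    ∀ᵐ x ∂μ, ((ENNReal.ofReal Q ^ (1 / N))⁻¹ *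
        (tau K N (1 - t) (dist x (T x)) * μ.rnDeriv (densityMeasure h) x ^ (-(1 / N)) +
          tau K N t (dist x (T x)) * (μ.map T).rnDeriv (densityMeasure h) (T x) ^ (-(1 / N))) ≤
        (μ.map (interpolate T t)).rnDeriv (densityMeasure h) (interpolate T t x) ^ (-(1 / N)) ↔
      TangentIneq Q K N t (dist x (T x)) (ENNReal.ofReal (deriv T x)) (h x) (h (T x))
        (h (interpolate T t x))) := by
  have hTt := measurable_interpolate hT t
  have := Measure.isProbabilityMeasure_map (μ := μ) hT.aemeasurable
  have := Measure.isProbabilityMeasure_map (μ := μ) hTt.aemeasurable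
  have vol := hμ.trans (densityMeasure_ac h)
  have volT := hμT.trans (densityMeasure_ac h)
  have volt := hμt.trans (densityMeasure_ac h)
  have hd : ∀ᵐ x ∂μ, HasDerivAt T (deriv T x) x := by
    filter_upwards [hs, vol.ae_le hmono.ae_differentiableWithinAt_of_mem] with x hx hdx
    exact ((hdx hx).differentiableAt (hso.mem_nhds hx)).hasDerivAt
  have hdt : ∀ᵐ x ∂μ, HasDerivAt (interpolate T t) ((1 - t) + t * deriv T x) x := by
    filter_upwards [hd] with x hx
    have h1 := ((hasDerivAt_id x).const_mul (1 - t)).add (hx.const_mul t)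
    rw [mul_one] at h1
    exact h1
  have j1 := ae_rnDeriv_eq_mul_deriv vol hT volT hso hs hcdf hd
  -- The interpolation is strictly increasing on `s`, so its distribution function identity is
  -- automatic; for `T`, only monotone, it is the hypothesis `hcdf`.
  have jt := ae_rnDeriv_eq_mul_deriv vol hTt volt hso hs (fun x hx =>
    cdf_map_of_strictMonoOn hTt hs (strictMonoOn_interpolate hmono ht0.le ht1) hx) hdt
  have r1 := ae_of_ae_map hT.aemeasurable (ae_rnDeriv_volume hh hμT)
  have rt := ae_of_ae_map hTt.aemeasurable (ae_rnDeriv_volume hh hμt)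
  filter_upwards [j1, jt, ae_rnDeriv_volume hh hμ, r1, rt] with x a1 at' ⟨b0, c0, d0, k0⟩
    ⟨b1, c1, d1, k1⟩ ⟨bt, ct, dt, kt⟩
  have hp : 0 ≤ 1 / N := by positivity
  have f00 : μ.rnDeriv volume x ≠ 0 := by
    rw [b0]; exact mul_ne_zero c0 (by simpa using k0)
  have f0t : μ.rnDeriv volume x ≠ ⊤ := by
    rw [b0]; exact ENNReal.mul_ne_top d0 (by simp)
  have f1t : (μ.map T).rnDeriv volume (T x) ≠ ⊤ := by
    rw [b1]; exact ENNReal.mul_ne_top d1 (by simp)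
  have ftt : (μ.map (interpolate T t)).rnDeriv volume (interpolate T t x) ≠ ⊤ := by
    rw [bt]; exact ENNReal.mul_ne_top dt (by simp)
  obtain ⟨l1, e1⟩ := ennreal_jacobian f00 f0t f1t a1
  obtain ⟨lt, et⟩ := ennreal_jacobian f00 f0t ftt at'
  -- The derivatives at times 0, 1 and `t` are `1`, `T'` and `1 - t + t T'`.
  rw [rpow_neg_eq_of_jacobian hp b0 c0 d0 k0 one_ne_zero (by simp) (mul_one _).symm, one_mul,
    rpow_neg_eq_of_jacobian hp b1 c1 d1 k1 (by simpa using l1) (by simp) e1,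
    rpow_neg_eq_of_jacobian hp bt ct dt kt (by simpa using lt) (by simp) et, TangentIneq,
    ← ENNReal.ofReal_mul ht0.le, ← ENNReal.ofReal_add (by linarith) (by positivity),
    ← mul_assoc, ← mul_assoc, ← add_mul, ← mul_assoc, ENNReal.mul_le_mul_iff_left]
  · simp only [ne_eq, ENNReal.inv_eq_zero]
    exact ENNReal.rpow_ne_top_of_nonneg hp f0t
  · simp [ENNReal.rpow_eq_zero_iff, f00, f0t]

end Density

/-! ### Optimal dynamical plans induced by monotone maps -/

/-- The dynamical map that sends `x` to the geodesic from `x` to `T x`. -/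
def mapGeo (T : ℝ → ℝ) (x : ℝ) : Geo ℝ := lineGeo (x, T x)

theorem eval_mapGeo (T : ℝ → ℝ) (t : I) (x : ℝ) : (mapGeo T x).eval t = interpolate T t x := rfl

theorem eval_zero_mapGeo (T : ℝ → ℝ) (x : ℝ) : (mapGeo T x).eval 0 = x := by
  simp [eval_mapGeo, interpolate]

theorem eval_one_mapGeo (T : ℝ → ℝ) (x : ℝ) : (mapGeo T x).eval 1 = T x := by
  simp [eval_mapGeo, interpolate]

theorem measurable_mapGeo {T : ℝ → ℝ} (hT : Measurable T) : Measurable (mapGeo T) :=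
  measurable_lineGeo.comp (measurable_id.prodMk hT)

/-- Lets almost everywhere statements about geodesics be read at their starting points without
checking measurability of the predicate. -/
theorem measurableEmbedding_mapGeo {T : ℝ → ℝ} (hT : Measurable T) :
    MeasurableEmbedding (mapGeo T) := by
  refine MeasurableEmbedding.of_measurable_inverse (measurable_mapGeo hT) ?_
    (Geo.measurable_eval 0) (eval_zero_mapGeo T)
  have e : range (mapGeo T) = {γ | T (Geo.eval 0 γ) = Geo.eval 1 γ} := by
    ext γ
    constructor
    · rintro ⟨x, rfl⟩
      rw [mem_ofPred_eq, eval_zero_mapGeo, eval_one_mapGeo]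
    · intro hγ
      rw [mem_ofPred_eq] at hγ
      refine ⟨Geo.eval 0 γ, ?_⟩
      rw [mapGeo, hγ, lineGeo_ends]
  rw [e]
  exact measurableSet_eq_fun (hT.comp (Geo.measurable_eval 0)) (Geo.measurable_eval 1)

theorem map_eval_map_mapGeo {T : ℝ → ℝ} (hT : Measurable T) (μ : Measure ℝ) (t : I) :
    (μ.map (mapGeo T)).map (Geo.eval t) = μ.map (interpolate T t) := by
  rw [Measure.map_map (Geo.measurable_eval t) (measurable_mapGeo hT)]
  rfl

theorem isOptimalPlan_iff_of_monotone {μ₀ μ₁ : Measure ℝ} (h₀ : IsP2 μ₀) (h₁ : IsP2 μ₁)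
    {π₀ π : Measure (ℝ × ℝ)} (hmono : IsMonotonePlan μ₀ μ₁ π₀) :
    IsOptimalPlan μ₀ μ₁ π ↔ π = π₀ := by
  have := h₀.1
  have := h₁.1
  exact hmono.isOptimalPlan_iff (transportCost_ne_top h₀ h₁ hmono.1)

theorem isOptimalDynamicalPlan_iff_of_monotone {μ₀ μ₁ : Measure ℝ} (h₀ : IsP2 μ₀) (h₁ : IsP2 μ₁)
    {T : ℝ → ℝ} (hT : Measurable T) (hmono : IsMonotonePlan μ₀ μ₁ (μ₀.map fun x => (x, T x)))
    {ν : Measure (Geo ℝ)} : IsOptimalDynamicalPlan μ₀ μ₁ ν ↔ ν = μ₀.map (mapGeo T) := by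
  have := h₀.1
  have e : μ₀.map (mapGeo T) = (μ₀.map fun x => (x, T x)).map lineGeo := by
    have hg : Measurable fun x => (x, T x) := measurable_id.prodMk hT
    rw [Measure.map_map measurable_lineGeo hg]
    rfl
  rw [IsOptimalDynamicalPlan, isOptimalPlan_iff_of_monotone h₀ h₁ hmono, e]
  constructor
  · rintro ⟨-, h⟩
    rw [← h, map_lineGeo_map_ends]
  · rintro rfl
    refine ⟨?_, map_ends_map_lineGeo _⟩
    rw [← e]
    exact Measure.isProbabilityMeasure_map (measurable_mapGeo hT).aemeasurable

/-! ### From densities to spaces -/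

section FromDensity

variable {h : ℝ → ℝ≥0}

theorem isLocallyFiniteMeasure_densityMeasure (hc : ContinuousOn h (densitySupport h)) :
    IsLocallyFiniteMeasure (densityMeasure h) := by
  refine ⟨fun x => ?_⟩
  by_cases hx : x ∈ densitySupport h
  · have h1 : ∀ᶠ y in 𝓝 x, y ∈ densitySupport h → h y < h x + 1 :=
      eventually_nhdsWithin_iff.1 ((hc x hx).eventually_lt_const (by simp))
    obtain ⟨r, hr, hb⟩ := Metric.eventually_nhds_iff_ball.1 h1
    refine ⟨Metric.ball x r, Metric.ball_mem_nhds x hr, ?_⟩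
    rw [← measure_inter_conull' (t := densitySupport h) (measure_mono_null
      (sdiff_subset_compl _ _) Measure.measure_compl_support)]
    have hm : MeasurableSet (Metric.ball x r ∩ densitySupport h) :=
      measurableSet_ball.inter Measure.isClosed_support.measurableSet
    rw [densityMeasure, withDensity_apply _ hm]
    calc ∫⁻ y in Metric.ball x r ∩ densitySupport h, (h y : ℝ≥0∞)
        ≤ ∫⁻ _ in Metric.ball x r ∩ densitySupport h, ((h x + 1 : ℝ≥0) : ℝ≥0∞) :=
          setLIntegral_mono measurable_const fun y hy =>
            ENNReal.coe_le_coe.2 (hb y hy.1 hy.2).le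
      _ = ((h x + 1 : ℝ≥0) : ℝ≥0∞) * volume (Metric.ball x r ∩ densitySupport h) := by
          rw [setLIntegral_const]
      _ ≤ ((h x + 1 : ℝ≥0) : ℝ≥0∞) * volume (Metric.ball x r) := by
          gcongr
          exact inter_subset_left
      _ < ⊤ := ENNReal.mul_lt_top ENNReal.coe_lt_top measure_ball_lt_top
  · obtain ⟨U, hU, hU0⟩ := Measure.notMem_support_iff_exists.1 hx
    exact ⟨U, hU, hU0 ▸ ENNReal.zero_lt_top⟩

theorem IsQCDDensity.densityIneq {Q K N : ℝ} (hq : IsQCDDensity Q K N h) {x y : ℝ}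
    (hx : x ∈ densitySupport h) (hy : y ∈ densitySupport h) {t : ℝ} (ht0 : 0 < t) (ht1 : t < 1) :
    DensityIneq Q K N t |y - x| (h x) (h y) (h ((1 - t) * x + t * y)) := by
  rw [add_comm ((1 - t) * x)]
  exact hq.2 x hx y hy t ht0 ht1

/-- The coefficient of `h x` is positive for `t < 1`. The end point `y` may be a zero of `h`, as the
Monge property allows any target measure on the support. -/
theorem IsQCDDensity.ne_zero {Q K N : ℝ} (hN : 1 < N) (hq : IsQCDDensity Q K N h) {x y : ℝ}
    (hx : x ∈ densitySupport h) (hx0 : h x ≠ 0) (hy : y ∈ densitySupport h) {t : ℝ} (ht0 : 0 ≤ t)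
    (ht1 : t < 1) : h ((1 - t) * x + t * y) ≠ 0 := by
  rcases ht0.eq_or_lt with rfl | ht0
  · simpa using hx0
  · intro h0
    have hN1 : 0 < N - 1 := by linarith
    have h1 := hq.densityIneq hx hy ht0 ht1
    rw [DensityIneq, h0, ENNReal.coe_zero, ENNReal.zero_rpow_of_pos (by positivity),
      nonpos_iff_eq_zero, mul_eq_zero, add_eq_zero, mul_eq_zero] at h1
    rcases h1 with h1 | ⟨h1 | h1, -⟩
    · rw [ENNReal.inv_eq_zero] at h1
      exact ENNReal.rpow_ne_top_of_nonneg (by positivity) (by simp) h1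
    · exact sigma_pos hN1 (by linarith) (by linarith) (abs_nonneg _) h1
    · rw [ENNReal.rpow_eq_zero_iff] at h1
      simp [hx0] at h1

theorem IsQCDDensity.map_interpolate_ac {Q K N : ℝ} (hN : 1 < N) (hh : AEMeasurable h volume)
    (hq : IsQCDDensity Q K N h) {μ₀ : Measure ℝ} (h₀ : μ₀ ≪ densityMeasure h) {T : ℝ → ℝ}
    (hT : Measurable T) {s : Set ℝ} (hs : ∀ᵐ x ∂μ₀, x ∈ s) (hmono : MonotoneOn T s)
    (hsupp : ∀ᵐ x ∂μ₀, T x ∈ densitySupport h) {t : ℝ} (ht0 : 0 ≤ t) (ht1 : t < 1) :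
    μ₀.map (interpolate T t) ≪ densityMeasure h := by
  have hTt := measurable_interpolate hT t
  have hac : μ₀.map (interpolate T t) ≪ volume := map_absolutelyContinuous_of_expanding
    (h₀.trans (densityMeasure_ac h)) hTt hs (sub_pos.2 ht1) (interpolate_expanding hmono ht0)
  refine absolutelyContinuous_densityMeasure hh hac ?_
  -- As `h` is only almost everywhere measurable, positivity is pushed forward through a measurable
  -- representative `k`.
  obtain ⟨k, hk, hhk⟩ := hh
  have key : ∀ᵐ x ∂μ₀, h (interpolate T t x) ≠ 0 := by
    filter_upwards [hsupp, h₀.ae_le (ae_densityMeasure_ne_zero ⟨k, hk, hhk⟩),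
      h₀.ae_le Measure.support_mem_ae] with x h1 h2 h3
    exact hq.ne_zero hN h3 h2 h1 ht0 ht1
  have hk0 : ∀ᵐ y ∂μ₀.map (interpolate T t), k y ≠ 0 := by
    have hm : MeasurableSet {y | k y ≠ 0} := hk (measurableSet_singleton 0).compl
    rw [ae_map_iff hTt.aemeasurable hm]
    filter_upwards [key, ae_of_ae_map hTt.aemeasurable (hac.ae_le hhk)] with x a b
    rwa [← b]
  filter_upwards [hk0, hac.ae_le hhk] with y a b
  rwa [b]

theorem IsQCDDensity.isMonge {Q K N : ℝ} (hN : 1 < N) (hh : AEMeasurable h volume)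
    (hq : IsQCDDensity Q K N h) : IsMonge (densityMeasure h) := by
  refine ⟨isLocallyFiniteMeasure_densityMeasure hq.1, fun μ₀ μ₁ h₀ h₁ hac hsupp => ?_⟩
  have := h₀.1
  have := h₁.1
  have hc := continuous_cdf (hac.trans (densityMeasure_ac h))
  have hT := measurable_rearrangement μ₀ μ₁
  have hplan : IsMonotonePlan μ₀ μ₁ (μ₀.map fun x => (x, rearrangement μ₀ μ₁ x)) :=
    isMonotonePlan_rearrangement hc
  refine ⟨⟨_, (isOptimalPlan_iff_of_monotone h₀ h₁ hplan).2 rfl,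
    fun π hπ => (isOptimalPlan_iff_of_monotone h₀ h₁ hplan).1 hπ⟩, μ₀.map (mapGeo _),
    (isOptimalDynamicalPlan_iff_of_monotone h₀ h₁ hT hplan).2 rfl,
    fun ν hν => (isOptimalDynamicalPlan_iff_of_monotone h₀ h₁ hT hplan).1 hν,
    ⟨_, measurable_mapGeo hT, rfl⟩, fun t ht => ?_⟩
  rw [map_eval_map_mapGeo hT]
  refine hq.map_interpolate_ac hN hh hac hT (ae_mem_cdfInterior hc)
    (monotoneOn_rearrangement μ₀ μ₁) (ae_of_ae_map hT.aemeasurable ?_) t.2.1 ht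
  rw [map_rearrangement hc]
  filter_upwards [Measure.support_mem_ae (μ := μ₁)] with y hy using hsupp hy

theorem IsQCDDensity.satisfiesQCD {Q K N : ℝ} (hN : 1 < N) (hh : AEMeasurable h volume)
    (hq : IsQCDDensity Q K N h) : SatisfiesQCD Q K N (densityMeasure h) := by
  refine ⟨hq.isMonge hN hh, fun μ₀ μ₁ h₀ h₁ hac₀ hac₁ ν hν t ht0 ht1 => ?_⟩
  have := h₀.1
  have := h₁.1
  have ht0' : (0 : ℝ) < t := ht0
  have ht1' : (t : ℝ) < 1 := ht1
  have hc₀ := continuous_cdf (hac₀.trans (densityMeasure_ac h))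
  have hc₁ := continuous_cdf (hac₁.trans (densityMeasure_ac h))
  have hT := measurable_rearrangement μ₀ μ₁
  have hplan : IsMonotonePlan μ₀ μ₁ (μ₀.map fun x => (x, rearrangement μ₀ μ₁ x)) :=
    isMonotonePlan_rearrangement hc₀
  have hmap : μ₀.map (rearrangement μ₀ μ₁) = μ₁ := map_rearrangement hc₀
  have hs := ae_mem_cdfInterior hc₀
  have hmono := monotoneOn_rearrangement μ₀ μ₁
  have hsupp : ∀ᵐ x ∂μ₀, rearrangement μ₀ μ₁ x ∈ densitySupport h := by
    refine ae_of_ae_map hT.aemeasurable ?_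
    rw [hmap]
    exact hac₁.ae_le Measure.support_mem_ae
  rw [(isOptimalDynamicalPlan_iff_of_monotone h₀.isP2 h₁.isP2 hT hplan).1 hν,
    (measurableEmbedding_mapGeo hT).ae_map_iff, map_eval_map_mapGeo hT]
  have key := ae_qcd_iff_tangentIneq (Q := Q) (K := K) hh hac₀ hT
    (isOpen_Ioo.preimage hc₀ : IsOpen (cdfInterior μ₀)) hs hmono
    (fun x hx => by rw [hmap]; exact cdf_rearrangement hc₁ hx) (by rwa [hmap]) ht0' ht1'
    (hq.map_interpolate_ac hN hh hac₀ hT hs hmono hsupp ht0'.le ht1') hN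
  filter_upwards [key, hsupp, hac₀.ae_le Measure.support_mem_ae] with x hx hTx hxs
  rw [hmap] at hx
  rw [eval_zero_mapGeo, eval_one_mapGeo, eval_mapGeo, hx, dist_comm, Real.dist_eq]
  exact (hq.densityIneq hxs hTx ht0' ht1').tangentIneq hN _

end FromDensity

/-! ### From spaces to densities -/

theorem IsPc.of_ae_mem {μ : Measure ℝ} [IsProbabilityMeasure μ] {s : Set ℝ}
    (hb : Bornology.IsBounded s) (h : ∀ᵐ x ∂μ, x ∈ s) : IsPc μ :=
  ⟨inferInstance, hb.closure.subset (Measure.support_subset_of_isClosed isClosed_closure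
    (mem_of_superset h subset_closure))⟩

theorem ae_eval_zero {μ₀ μ₁ : Measure ℝ} {ν : Measure (Geo ℝ)}
    (hν : IsOptimalDynamicalPlan μ₀ μ₁ ν) {p : ℝ → Prop} (hp : ∀ᵐ x ∂μ₀, p x) :
    ∀ᵐ γ ∂ν, p (Geo.eval 0 γ) := by
  rw [← hν.2.1.1] at hp
  exact ae_of_ae_map Geo.measurable_ends.aemeasurable (ae_of_ae_map measurable_fst.aemeasurable hp)

theorem ae_eval_one {μ₀ μ₁ : Measure ℝ} {ν : Measure (Geo ℝ)}
    (hν : IsOptimalDynamicalPlan μ₀ μ₁ ν) {p : ℝ → Prop} (hp : ∀ᵐ x ∂μ₁, p x) :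
    ∀ᵐ γ ∂ν, p (Geo.eval 1 γ) := by
  rw [← hν.2.1.2] at hp
  exact ae_of_ae_map Geo.measurable_ends.aemeasurable (ae_of_ae_map measurable_snd.aemeasurable hp)

/-- Transport normalized `m` between balls of equal radius about `x` and `y`: at the intermediate
time all mass lies in the ball of that radius about the intermediate point, which therefore cannot
be `m`-null. The curvature inequality plays no role. -/
theorem IsMonge.convex_support {m : Measure ℝ} (hm : IsMonge m) : Convex ℝ m.support := by
  have := hm.locallyFinite
  rw [convex_iff_forall_pos]
  intro x hx y hy a b ha hb hab
  obtain rfl : a = 1 - b := by linarith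
  simp only [smul_eq_mul]
  rw [Measure.mem_support_iff_forall]
  intro U hU
  obtain ⟨r, hr, hrU⟩ := Metric.mem_nhds_iff.1 hU
  have hx0 := (Measure.mem_support_iff_forall x).1 hx _ (Metric.ball_mem_nhds x hr)
  have hy0 := (Measure.mem_support_iff_forall y).1 hy _ (Metric.ball_mem_nhds y hr)
  have p0 := cond_isProbabilityMeasure_of_finite hx0.ne' measure_ball_lt_top.ne
  have p1 := cond_isProbabilityMeasure_of_finite hy0.ne' measure_ball_lt_top.ne
  have m0 : ∀ᵐ z ∂m[|Metric.ball x r], z ∈ Metric.ball x r := ae_cond_mem measurableSet_ball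
  have m1 : ∀ᵐ z ∂m[|Metric.ball y r], z ∈ Metric.ball y r := ae_cond_mem measurableSet_ball
  obtain ⟨-, ν, hν, -, -, hac⟩ := hm.monge _ _ (IsPc.of_ae_mem Metric.isBounded_ball m0).isP2
    (IsPc.of_ae_mem Metric.isBounded_ball m1).isP2 cond_absolutelyContinuous
    cond_absolutelyContinuous.support_mono
  have := hν.1
  have hmem : ∀ᵐ γ ∂ν, Geo.eval ⟨b, hb.le, by linarith⟩ γ ∈
      Metric.ball ((1 - b) * x + b * y) r := by
    filter_upwards [ae_eval_zero hν m0, ae_eval_one hν m1] with γ h0 h1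
    rw [Geo.eval_real]
    rw [mem_ball_iff_norm] at h0 h1 ⊢
    rw [← mem_ball_zero_iff] at h0 h1 ⊢
    have h2 := convex_ball (0 : ℝ) r h0 h1 ha.le hb.le hab
    simp only [smul_eq_mul] at h2
    convert h2 using 1
    ring
  refine lt_of_lt_of_le (pos_iff_ne_zero.2 fun h0 => ?_) (measure_mono hrU)
  have h1 := hac ⟨b, hb.le, by linarith⟩ (by rw [← Subtype.coe_lt_coe]; simpa using ha) h0
  rw [Measure.map_apply (Geo.measurable_eval _) measurableSet_ball] at h1
  have h2 : ∀ᵐ γ ∂ν, False := by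
    filter_upwards [hmem, measure_eq_zero_iff_ae_notMem.1 h1] with γ a b using b a
  simp at h2
  exact IsProbabilityMeasure.ne_zero ν h2

section ToDensity

variable {h : ℝ → ℝ≥0}

/-- The interior points of the support at which the density is positive. -/
def positiveInterior (h : ℝ → ℝ≥0) : Set ℝ := interior (densitySupport h) ∩ {x | h x ≠ 0}

theorem positiveInterior_subset : positiveInterior h ⊆ densitySupport h :=
  fun _ hx => interior_subset hx.1

theorem isOpen_positiveInterior (hc : ContinuousOn h (densitySupport h)) :
    IsOpen (positiveInterior h) :=
  (hc.mono interior_subset).isOpen_inter_preimage isOpen_interior isOpen_compl_singleton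

/-- The frontier of a convex set is Lebesgue null, so the positive interior has full `densityMeasure
h`. -/
theorem densitySupport_subset_closure (hh : AEMeasurable h volume)
    (hconv : Convex ℝ (densitySupport h)) :
    densitySupport h ⊆ closure (positiveInterior h) := by
  intro x hx
  rw [mem_closure_iff_nhds]
  intro U hU
  have hU0 := (Measure.mem_support_iff_forall x).1 hx U hU
  have hfr : densityMeasure h (frontier (densitySupport h)) = 0 :=
    densityMeasure_ac h (hconv.addHaar_frontier volume)
  have hfr' : ∀ᵐ y ∂densityMeasure h, y ∉ frontier (densitySupport h) :=
    measure_eq_zero_iff_ae_notMem.1 hfr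
  have hsup : ∀ᵐ y ∂densityMeasure h, y ∈ densitySupport h := Measure.support_mem_ae
  have hae : ∀ᵐ y ∂densityMeasure h, y ∈ positiveInterior h := by
    filter_upwards [hfr', hsup, ae_densityMeasure_ne_zero hh] with y h1 h2 h3
    refine ⟨?_, h3⟩
    by_contra h4
    exact h1 ⟨subset_closure h2, h4⟩
  rw [← measure_inter_conull' (t := positiveInterior h) (measure_mono_null
      (sdiff_subset_compl _ _) (ae_iff.1 hae))] at hU0
  exact nonempty_of_measure_ne_zero hU0.ne'

/-- The test transport is the affine map of slope `l` taking `x₀` to `x₁`, applied to the uniform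
measure on a ball so small that it and its image stay where `h` is positive. Being increasing, the
map is optimal. -/
theorem exists_ae_tangentIneq (hh : AEMeasurable h volume)
    (hc : ContinuousOn h (densitySupport h)) {Q K N : ℝ} (hN : 1 < N)
    (hq : SatisfiesQCD Q K N (densityMeasure h)) {x₀ x₁ : ℝ} (hx₀ : x₀ ∈ positiveInterior h)
    (hx₁ : x₁ ∈ positiveInterior h) {l : ℝ} (hl : 0 < l) {t : ℝ} (ht0 : 0 < t) (ht1 : t < 1) :
    ∃ r > 0, ∀ᵐ x ∂volume[|Metric.ball x₀ r], TangentIneq Q K N t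
      (dist x (x₁ + l * (x - x₀))) (ENNReal.ofReal l) (h x) (h (x₁ + l * (x - x₀)))
        (h (interpolate (fun x => x₁ + l * (x - x₀)) t x)) := by
  set T : ℝ → ℝ := fun x => x₁ + l * (x - x₀) with hTdef
  have hTc : Continuous T := by fun_prop
  have hT : Measurable T := hTc.measurable
  have hP := isOpen_positiveInterior hc
  have hT0 : T x₀ = x₁ := by simp [T]
  have hnhds : positiveInterior h ∩ T ⁻¹' positiveInterior h ∈ 𝓝 x₀ :=
    inter_mem (hP.mem_nhds hx₀) (hTc.continuousAt (hP.mem_nhds (by rwa [hT0])))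
  obtain ⟨r, hr, hrP⟩ := Metric.mem_nhds_iff.1 hnhds
  refine ⟨r, hr, ?_⟩
  have hvol : volume (Metric.ball x₀ r) ≠ 0 := (Metric.measure_ball_pos _ _ hr).ne'
  have := cond_isProbabilityMeasure_of_finite hvol measure_ball_lt_top.ne
  have hmem : ∀ᵐ x ∂volume[|Metric.ball x₀ r], x ∈ Metric.ball x₀ r :=
    ae_cond_mem measurableSet_ball
  have hvol0 : volume[|Metric.ball x₀ r] ≪ volume := cond_absolutelyContinuous
  generalize volume[|Metric.ball x₀ r] = μ at *
  have := Measure.isProbabilityMeasure_map (μ := μ) hT.aemeasurable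
  have hac₀ : μ ≪ densityMeasure h := absolutelyContinuous_densityMeasure hh hvol0 (by
    filter_upwards [hmem] with x hx using (hrP hx).1.2)
  have hmem₁ : ∀ᵐ y ∂μ.map T, y ∈ positiveInterior h := by
    rw [ae_map_iff hT.aemeasurable (p := (· ∈ positiveInterior h)) hP.measurableSet]
    filter_upwards [hmem] with x hx using (hrP hx).2
  have hac₁ : μ.map T ≪ densityMeasure h := by
    refine absolutelyContinuous_densityMeasure hh (map_absolutelyContinuous_of_expanding hvol0 hT
      (s := univ) (by simp) hl fun x _ y _ => ?_) (by
        filter_upwards [hmem₁] with y hy using hy.2)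
    have e : T x - T y = l * (x - y) := by simp only [T]; ring
    rw [e, abs_mul, abs_of_pos hl]
  have hpc₀ : IsPc μ := IsPc.of_ae_mem Metric.isBounded_ball hmem
  have hpc₁ : IsPc (μ.map T) := by
    refine IsPc.of_ae_mem (s := T '' Metric.closedBall x₀ r)
      ((isCompact_closedBall x₀ r).image hTc).isBounded ?_
    rw [ae_map_iff hT.aemeasurable (p := (· ∈ T '' Metric.closedBall x₀ r))
      ((isCompact_closedBall x₀ r).image hTc).measurableSet]
    filter_upwards [hmem] with x hx using mem_image_of_mem _ (Metric.ball_subset_closedBall hx)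
  have hstrict : StrictMono T := fun x y hxy => by
    have := mul_pos hl (sub_pos.2 hxy)
    simp only [T]
    linarith
  have hplan : IsMonotonePlan μ (μ.map T) (μ.map fun x => (x, T x)) :=
    isMonotonePlan_of_monotoneOn hT (s := univ) (by simp) (hstrict.monotone.monotoneOn _)
  have hopt := isOptimalDynamicalPlan_iff_of_monotone (ν := μ.map (mapGeo T)) hpc₀.isP2 hpc₁.isP2
    hT hplan |>.2 rfl
  obtain ⟨-, ν, hν, hνu, -, hνac⟩ := hq.1.monge _ _ hpc₀.isP2 hpc₁.isP2 hac₀ hac₁.support_mono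
  have hact := hνac ⟨t, ht0.le, ht1.le⟩ ht1
  rw [← hνu _ hopt, map_eval_map_mapGeo hT] at hact
  have hineq := hq.2 _ _ hpc₀ hpc₁ hac₀ hac₁ _ hopt ⟨t, ht0.le, ht1.le⟩ ht0 ht1
  rw [(measurableEmbedding_mapGeo hT).ae_map_iff, map_eval_map_mapGeo hT] at hineq
  have key := ae_qcd_iff_tangentIneq (Q := Q) (K := K) hh hac₀ hT isOpen_univ (by simp)
    (hstrict.monotone.monotoneOn univ)
    (fun x hx => cdf_map_of_strictMonoOn hT (by simp) (hstrict.strictMonoOn univ) hx) hac₁ ht0 ht1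
    hact hN
  filter_upwards [key, hineq] with x hx hxi
  rw [eval_zero_mapGeo, eval_one_mapGeo, eval_mapGeo] at hxi
  have hd : deriv T x = l := by simp [T]
  rw [hd] at hx
  exact hx.1 hxi

/-- A set of full measure in a ball accumulates at its center, and both sides are continuous there.
-/
theorem tangentIneq_of_satisfiesQCD (hh : AEMeasurable h volume)
    (hc : ContinuousOn h (densitySupport h)) {Q K N : ℝ} (hN : 1 < N) (hQ : 1 ≤ Q)
    (hq : SatisfiesQCD Q K N (densityMeasure h)) {x₀ x₁ : ℝ} (hx₀ : x₀ ∈ positiveInterior h)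
    (hx₁ : x₁ ∈ positiveInterior h) (hne : x₀ ≠ x₁) {l : ℝ} (hl : 0 < l) {t : ℝ} (ht0 : 0 < t)
    (ht1 : t < 1) :
    TangentIneq Q K N t |x₁ - x₀| (ENNReal.ofReal l) (h x₀) (h x₁) (h ((1 - t) * x₀ + t * x₁)) := by
  obtain ⟨r, hr, hae⟩ := exists_ae_tangentIneq hh hc hN hq hx₀ hx₁ hl ht0 ht1
  set T : ℝ → ℝ := fun x => x₁ + l * (x - x₀) with hTdef
  have hTc : Continuous T := by fun_prop
  have hT0 : T x₀ = x₁ := by simp [T]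
  have hTt : Continuous (interpolate T t) := by unfold interpolate; fun_prop
  have hTt0 : interpolate T t x₀ = (1 - t) * x₀ + t * x₁ := by rw [interpolate, hT0]
  set A : Set ℝ := {x | TangentIneq Q K N t (dist x (T x)) (ENNReal.ofReal l) (h x) (h (T x))
    (h (interpolate T t x))} with hA
  have hclos : x₀ ∈ closure A := by
    rw [Metric.mem_closure_iff]
    intro ε hε
    have hsub : volume (Metric.ball x₀ ε ∩ Metric.ball x₀ r) ≠ 0 := by
      refine (IsOpen.measure_pos _ (Metric.isOpen_ball.inter Metric.isOpen_ball) ⟨x₀, ?_⟩).ne'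
      exact ⟨Metric.mem_ball_self hε, Metric.mem_ball_self hr⟩
    rw [ProbabilityTheory.cond, Measure.ae_ennreal_smul_measure_iff
      (ENNReal.inv_ne_zero.2 measure_ball_lt_top.ne), ae_restrict_iff' measurableSet_ball] at hae
    by_contra! hcon
    apply hsub
    refine measure_mono_null ?_ (ae_iff.1 hae)
    rintro x ⟨h1, h2⟩ h3
    have h4 := hcon x (h3 h2)
    rw [Metric.mem_ball, dist_comm] at h1
    linarith
  have : (𝓝[A] x₀).NeBot := mem_closure_iff_nhdsWithin_neBot.1 hclos
  have hcont : ∀ x ∈ interior (densitySupport h), ContinuousAt (fun x => (h x : ℝ≥0∞)) x :=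
    fun x hx => ENNReal.continuous_coe.continuousAt.comp
      (hc.continuousAt (mem_interior_iff_mem_nhds.1 hx))
  have hp : 0 ≤ 1 / N := by positivity
  have hxt : (1 - t) * x₀ + t * x₁ ∈ interior (densitySupport h) :=
    hq.1.convex_support.interior hx₀.1 hx₁.1 (by linarith) ht0.le (by ring)
  have lim₀ : Tendsto (fun x => (h x : ℝ≥0∞) ^ (1 / N)) (𝓝 x₀) (𝓝 ((h x₀ : ℝ≥0∞) ^ (1 / N))) :=
    ENNReal.continuous_rpow_const.continuousAt.comp (hcont x₀ hx₀.1)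
  have lim₁ : Tendsto (fun x => (ENNReal.ofReal l * (h (T x) : ℝ≥0∞)) ^ (1 / N)) (𝓝 x₀)
      (𝓝 ((ENNReal.ofReal l * (h x₁ : ℝ≥0∞)) ^ (1 / N))) := by
    refine (ENNReal.continuous_rpow_const.tendsto _).comp
      (ENNReal.Tendsto.const_mul ?_ (Or.inr ENNReal.ofReal_ne_top))
    have h1 : Tendsto T (𝓝 x₀) (𝓝 x₁) := hT0 ▸ hTc.tendsto x₀
    exact (hcont x₁ hx₁.1).tendsto.comp h1
  have limt : Tendsto (fun x => ((ENNReal.ofReal (1 - t) + ENNReal.ofReal t * ENNReal.ofReal l) *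
      (h (interpolate T t x) : ℝ≥0∞)) ^ (1 / N)) (𝓝 x₀) (𝓝 (((ENNReal.ofReal (1 - t) +
        ENNReal.ofReal t * ENNReal.ofReal l) * (h ((1 - t) * x₀ + t * x₁) : ℝ≥0∞)) ^ (1 / N))) := by
    refine (ENNReal.continuous_rpow_const.tendsto _).comp (ENNReal.Tendsto.const_mul ?_ (Or.inr
      (ENNReal.add_ne_top.2 ⟨by simp, ENNReal.mul_ne_top (by simp) (by simp)⟩)))
    have h1 : Tendsto (interpolate T t) (𝓝 x₀) (𝓝 ((1 - t) * x₀ + t * x₁)) :=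
      hTt0 ▸ hTt.tendsto x₀
    exact (hcont _ hxt).tendsto.comp h1
  have hθ : 0 < |x₁ - x₀| := abs_pos.2 (sub_ne_zero.2 hne.symm)
  have limd : Tendsto (fun x => dist x (T x)) (𝓝 x₀) (𝓝 |x₁ - x₀|) := by
    have h1 : Continuous fun x => dist x (T x) := by fun_prop
    have h2 := h1.tendsto x₀
    rwa [hT0, dist_comm, Real.dist_eq] at h2
  -- Multiplication in `[0,∞]` fails to be continuous only at `⊤ * 0`; positivity of `h` at both
  -- ends excludes this even if `tau` is `⊤`.
  have h00 : (h x₀ : ℝ≥0∞) ^ (1 / N) ≠ 0 := by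
    have : h x₀ ≠ 0 := hx₀.2
    simp [ENNReal.rpow_eq_zero_iff, this]
  have h10 : (ENNReal.ofReal l * (h x₁ : ℝ≥0∞)) ^ (1 / N) ≠ 0 := by
    have : h x₁ ≠ 0 := hx₁.2
    have h2 : ENNReal.ofReal l * (h x₁ : ℝ≥0∞) ≠ 0 := mul_ne_zero (by simpa) (by simpa)
    have h3 : ENNReal.ofReal l * (h x₁ : ℝ≥0∞) ≠ ⊤ := ENNReal.mul_ne_top (by simp) (by simp)
    simp only [ne_eq, ENNReal.rpow_eq_zero_iff, h2, h3, false_and, or_self, not_false_eq_true]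
  have hQ0 : (ENNReal.ofReal Q ^ (1 / N))⁻¹ ≠ ⊤ := by
    rw [Ne, ENNReal.inv_eq_top, ENNReal.rpow_eq_zero_iff]
    have : 0 < ENNReal.ofReal Q := ENNReal.ofReal_pos.2 (by linarith)
    simp [this.ne']
  have lhs := ENNReal.Tendsto.const_mul (((ENNReal.Tendsto.mul
    ((continuousAt_tau (K := K) hN (sub_pos.2 ht1) (by linarith) hθ).tendsto.comp limd)
    (Or.inr (ENNReal.rpow_ne_top_of_nonneg hp (by simp))) lim₀ (Or.inl h00))).add
    (ENNReal.Tendsto.mul ((continuousAt_tau (K := K) hN ht0 ht1 hθ).tendsto.comp limd)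
    (Or.inr (ENNReal.rpow_ne_top_of_nonneg hp (ENNReal.mul_ne_top (by simp) (by simp)))) lim₁
    (Or.inl h10))) (Or.inr hQ0)
  have hA_mem : ∀ᶠ x in 𝓝[A] x₀, x ∈ A := self_mem_nhdsWithin
  exact le_of_tendsto_of_tendsto (lhs.mono_left nhdsWithin_le_nhds)
    (limt.mono_left nhdsWithin_le_nhds) hA_mem

/-- Below the critical length, optimize over `l`. Beyond it, `l = 1` would bound an infinite left
side by a finite right side, so no such pair of points exists: a diameter bound of Bonnet–Myers
type. -/
theorem densityIneq_of_mem_positiveInterior (hh : AEMeasurable h volume)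
    (hc : ContinuousOn h (densitySupport h)) {Q K N : ℝ} (hN : 1 < N) (hQ : 1 ≤ Q)
    (hq : SatisfiesQCD Q K N (densityMeasure h)) {x₀ x₁ : ℝ} (hx₀ : x₀ ∈ positiveInterior h)
    (hx₁ : x₁ ∈ positiveInterior h) (hne : x₀ ≠ x₁) {t : ℝ} (ht0 : 0 < t) (ht1 : t < 1) :
    DensityIneq Q K N t |x₁ - x₀| (h x₀) (h x₁) (h ((1 - t) * x₀ + t * x₁)) := by
  have h0 : (h x₀ : ℝ≥0∞) ≠ 0 := by
    have : h x₀ ≠ 0 := hx₀.2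
    simpa
  have h1 : (h x₁ : ℝ≥0∞) ≠ 0 := by
    have : h x₁ ≠ 0 := hx₁.2
    simpa
  have hT := fun (l : ℝ) (hl : 0 < l) =>
    tangentIneq_of_satisfiesQCD hh hc hN hQ hq hx₀ hx₁ hne hl ht0 ht1
  by_cases hfin : K * |x₁ - x₀| ^ 2 < Real.pi ^ 2 * (N - 1)
  · refine densityIneq_of_tangentIneq hN ht0 ht1 (abs_nonneg _) hfin h0 (by simp) h1 (by simp)
      fun l hl0 hlt => ?_
    have := hT l.toReal (ENNReal.toReal_pos hl0 hlt)
    rwa [ENNReal.ofReal_toReal hlt] at this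
  · exfalso
    have h2 := hT 1 one_pos
    have hp : 0 < 1 / N := by positivity
    have hp1 : 0 < 1 - 1 / N := by
      rw [sub_pos, div_lt_one (by linarith)]
      exact hN
    have htau : tau K N (1 - t) |x₁ - x₀| = ⊤ := by
      rw [tau, sigma_eq_top_iff.2 (not_lt.1 hfin), ENNReal.top_rpow_of_pos hp1, ENNReal.mul_top]
      simp [ENNReal.rpow_eq_zero_iff, ht1]
    have h00 : (h x₀ : ℝ≥0∞) ^ (1 / N) ≠ 0 := by simp [ENNReal.rpow_eq_zero_iff, h0]
    rw [TangentIneq, htau, ENNReal.top_mul h00, top_add, ENNReal.mul_top, top_le_iff] at h2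
    · exact ENNReal.rpow_ne_top_of_nonneg hp.le (ENNReal.mul_ne_top (ENNReal.add_ne_top.2
        ⟨by simp, ENNReal.mul_ne_top (by simp) (by simp)⟩) (by simp)) h2
    · rw [Ne, ENNReal.inv_eq_zero]
      exact ENNReal.rpow_ne_top_of_nonneg hp.le (by simp)

theorem SatisfiesQCD.isQCDDensity (hh : AEMeasurable h volume)
    (hc : ContinuousOn h (densitySupport h)) {Q K N : ℝ} (hN : 1 < N) (hQ : 1 ≤ Q)
    (hq : SatisfiesQCD Q K N (densityMeasure h)) : IsQCDDensity Q K N h := by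
  refine ⟨hc, fun x hx y hy t ht0 ht1 => ?_⟩
  have hN1 : 0 < N - 1 := by linarith
  have hp : 0 < 1 / (N - 1) := by positivity
  have hQ1 : (ENNReal.ofReal Q ^ (1 / (N - 1)))⁻¹ ≤ 1 := by
    rw [ENNReal.inv_le_one]
    exact ENNReal.one_le_rpow (by simpa using hQ) hp
  have hQt : (ENNReal.ofReal Q ^ (1 / (N - 1)))⁻¹ ≠ ⊤ := (hQ1.trans_lt (by simp)).ne
  have hQ0 : (ENNReal.ofReal Q ^ (1 / (N - 1)))⁻¹ ≠ 0 := by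
    rw [Ne, ENNReal.inv_eq_zero]
    exact ENNReal.rpow_ne_top_of_nonneg hp.le (by simp)
  -- For `x = y` the coefficients add up to 1 and `Q ≥ 1` suffices; this case is separate because
  -- continuity of `sigma` is available only at positive lengths.
  rcases eq_or_ne x y with rfl | hne
  · have hs : ∀ u : ℝ, sigma K (N - 1) u |x - x| = ENNReal.ofReal u := by
      intro u
      have := Real.pi_pos
      have h1 : ¬ Real.pi ^ 2 * (N - 1) ≤ K * |x - x| ^ 2 := by
        rw [sub_self, abs_zero, not_le]
        simp only [ne_eq, OfNat.ofNat_ne_zero, not_false_eq_true, zero_pow, mul_zero]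
        positivity
      rw [sigma, if_neg h1, if_pos (by simp)]
    rw [hs, hs, ← add_mul, ← ENNReal.ofReal_add (by linarith) ht0.le,
      show t * x + (1 - t) * x = x by ring]
    simp only [sub_add_cancel, ENNReal.ofReal_one, one_mul]
    exact mul_le_of_le_one_left' hQ1
  rw [add_comm (t * y)]
  have hconv := hq.1.convex_support
  have hdense := densitySupport_subset_closure hh hconv
  have : (𝓝[positiveInterior h] x).NeBot := mem_closure_iff_nhdsWithin_neBot.1 (hdense hx)
  have : (𝓝[positiveInterior h] y).NeBot := mem_closure_iff_nhdsWithin_neBot.1 (hdense hy)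
  set F := 𝓝[positiveInterior h] x ×ˢ 𝓝[positiveInterior h] y with hF
  have hF_le : F ≤ 𝓝 (x, y) := by
    rw [nhds_prod_eq]
    exact Filter.prod_mono nhdsWithin_le_nhds nhdsWithin_le_nhds
  have hmem : ∀ᶠ p in F, p.1 ∈ positiveInterior h ∧ p.2 ∈ positiveInterior h :=
    prod_mem_prod self_mem_nhdsWithin self_mem_nhdsWithin
  have hneF : ∀ᶠ p in F, p.1 ≠ p.2 :=
    hF_le ((isOpen_ne_fun continuous_fst continuous_snd).mem_nhds hne)
  have hineq : ∀ᶠ p in F, DensityIneq Q K N t |p.2 - p.1| (h p.1) (h p.2)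
      (h ((1 - t) * p.1 + t * p.2)) := by
    filter_upwards [hmem, hneF] with p h1 h2
    exact densityIneq_of_mem_positiveInterior hh hc hN hQ hq h1.1 h1.2 h2 ht0 ht1
  have hcont : ∀ z ∈ densitySupport h, Tendsto (fun w => (h w : ℝ≥0∞) ^ (1 / (N - 1)))
      (𝓝[densitySupport h] z) (𝓝 ((h z : ℝ≥0∞) ^ (1 / (N - 1)))) := fun z hz =>
    (ENNReal.continuous_rpow_const.tendsto _).comp
      ((ENNReal.continuous_coe.tendsto _).comp (hc z hz))
  have lim₀ : Tendsto (fun p : ℝ × ℝ => (h p.1 : ℝ≥0∞) ^ (1 / (N - 1))) F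
      (𝓝 ((h x : ℝ≥0∞) ^ (1 / (N - 1)))) :=
    ((hcont x hx).mono_left (nhdsWithin_mono _ positiveInterior_subset)).comp tendsto_fst
  have lim₁ : Tendsto (fun p : ℝ × ℝ => (h p.2 : ℝ≥0∞) ^ (1 / (N - 1))) F
      (𝓝 ((h y : ℝ≥0∞) ^ (1 / (N - 1)))) :=
    ((hcont y hy).mono_left (nhdsWithin_mono _ positiveInterior_subset)).comp tendsto_snd
  have limt : Tendsto (fun p : ℝ × ℝ => (h ((1 - t) * p.1 + t * p.2) : ℝ≥0∞) ^ (1 / (N - 1))) F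
      (𝓝 ((h ((1 - t) * x + t * y) : ℝ≥0∞) ^ (1 / (N - 1)))) := by
    -- Continuity of `h` is known only along the support, and convexity keeps the intermediate
    -- points in it.
    refine (hcont _ (hconv hx hy (by linarith) ht0.le (by ring))).comp
      (tendsto_nhdsWithin_iff.2 ⟨?_, ?_⟩)
    · have h1 : Continuous fun p : ℝ × ℝ => (1 - t) * p.1 + t * p.2 := by fun_prop
      exact (h1.tendsto (x, y)).mono_left hF_le
    · filter_upwards [hmem] with p h1
      exact hconv (positiveInterior_subset h1.1) (positiveInterior_subset h1.2) (by linarith)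
        ht0.le (by ring)
  have limσ : ∀ u : ℝ, 0 < u → u < 1 → Tendsto (fun p : ℝ × ℝ => sigma K (N - 1) u |p.2 - p.1|) F
      (𝓝 (sigma K (N - 1) u |y - x|)) := by
    intro u hu0 hu1
    have h1 : Continuous fun p : ℝ × ℝ => |p.2 - p.1| := by fun_prop
    exact (continuousAt_sigma hN1 hu0 hu1 (abs_pos.2 (sub_ne_zero.2 hne.symm))).tendsto.comp
      ((h1.tendsto (x, y)).mono_left hF_le)
  have hfinite : ∀ z, (h z : ℝ≥0∞) ^ (1 / (N - 1)) ≠ ⊤ := fun z =>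
    ENNReal.rpow_ne_top_of_nonneg hp.le (by simp)
  have lσ₀ := limσ (1 - t) (by linarith) (by linarith)
  have lσ₁ := limσ t ht0 ht1
  by_cases hfin : Real.pi ^ 2 * (N - 1) ≤ K * |y - x| ^ 2
  · rw [sigma_eq_top_iff.2 hfin] at lσ₀ lσ₁ ⊢
    rw [sigma_eq_top_iff.2 hfin]
    -- At infinite coefficients a nonzero end value would send the left side to `⊤` while the right
    -- side has a finite limit. So both end values vanish, and `⊤ * 0 = 0` closes the case.
    have hzero : ∀ (z : ℝ) (f g : ℝ × ℝ → ℝ≥0∞), Tendsto f F (𝓝 ⊤) →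
        Tendsto g F (𝓝 ((h z : ℝ≥0∞) ^ (1 / (N - 1)))) →
        (∀ᶠ p in F, (ENNReal.ofReal Q ^ (1 / (N - 1)))⁻¹ * (f p * g p) ≤
          (h ((1 - t) * p.1 + t * p.2) : ℝ≥0∞) ^ (1 / (N - 1))) →
        (h z : ℝ≥0∞) ^ (1 / (N - 1)) = 0 := by
      intro z f g hf hg hle
      by_contra hz
      have l1 := ENNReal.Tendsto.const_mul
        (ENNReal.Tendsto.mul hf (Or.inl ENNReal.top_ne_zero) hg (Or.inl hz)) (Or.inr hQt)
      have l2 := le_of_tendsto_of_tendsto l1 limt hle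
      rw [ENNReal.top_mul hz, ENNReal.mul_top hQ0, top_le_iff] at l2
      exact hfinite _ l2
    rw [hzero x _ _ lσ₀ lim₀ (hineq.mono fun p hp => le_trans (by gcongr; exact le_self_add) hp),
      hzero y _ _ lσ₁ lim₁ (hineq.mono fun p hp => le_trans (by gcongr; exact le_add_self) hp)]
    simp
  · have hσ : ∀ u, sigma K (N - 1) u |y - x| ≠ ⊤ := fun u => by rwa [Ne, sigma_eq_top_iff]
    exact le_of_tendsto_of_tendsto (ENNReal.Tendsto.const_mul
      ((ENNReal.Tendsto.mul lσ₀ (Or.inr (hfinite x)) lim₀ (Or.inr (hσ _))).add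
        (ENNReal.Tendsto.mul lσ₁ (Or.inr (hfinite y)) lim₁ (Or.inr (hσ _)))) (Or.inr hQt))
      limt hineq

end ToDensity

end QCDSpace

theorem corollary4p2 (K N Q : ℝ) (hN : 1 < N) (hQ : 1 ≤ Q) (h : ℝ → ℝ≥0)
    (h_meas : AEMeasurable h volume)
    (h_cont : ContinuousOn h (QCDSpace.densitySupport h)) :
    QCDSpace.SatisfiesQCD Q K N (QCDSpace.densityMeasure h) ↔
      QCDSpace.IsQCDDensity Q K N h :=
  ⟨fun hq => hq.isQCDDensity h_meas h_cont hN hQ, fun hq => hq.satisfiesQCD hN h_meas⟩
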